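/- Let $d\ge 1$, and let $\kappa:\mathbb R^d\times\mathbb R^d\to\mathbb R$ be a stationary kernel: $\kappa$ is positive definite (all matrices $[\kappa(y_i,y_j)]$ on finitely many points are positive semi-definite) and $\kappa(x,y)=f(\|x-y\|_2)$ with $f$ analytic at $0$. Put $f_i=f^{(i)}(0)/i!$; the smoothness order of $\kappa$ is $r=\min\{r\ge 1: f_{2r-1}\neq 0\}$, with $r=\infty$ if there is no such integer. Let $k\ge 0$ be an integer with $k\le r-1$, and let $m=\mathscr P_{k,d}=\binom{k+d}{d}$. Assume that the Wronskian matrix $W_{\le k}=\big[\kappa^{(\alpha,\beta)}(0,0)/(\alpha!\,\beta!)\big]_{|\alpha|\le k,\,|\beta|\le k}$ is nonsingular. Let $x_1,\dots,x_n\in\mathbb R^d$, let $V_{\le k}=[x_i^{\alpha}]_{i,\,|\alpha|\le k}\in\mathbb R^{n\times m}$, and assume $\operatorname{rank}V_{\le k}=m$. For $\varepsilon>0$ let $L_\varepsilon=[f(\varepsilon\|x_i-x_j\|_2)]_{i,j=1}^n$. For a positive semi-definite matrix $L$ of size $n$, $|DPP|_m(L)$ is the random subset $\mathcal X$ of $\{1,\dots,n\}$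 with $\mathbb P(\mathcal X=X)=\det L_X/\sum_{|Y|=m}\det L_Y$ if $|X|=m$, and $\mathbb P(\mathcal X=X)=0$ otherwise; it is well defined when the sum is positive. Then $|DPP|_m(L_\varepsilon)$ is well defined for all sufficiently small $\varepsilon>0$, $|DPP|_m(V_{\le k}V_{\le k}^\top)$ is well defined, and as $\varepsilon\to0^+$ the former converges to the latter: $\mathbb P(\mathcal X_\varepsilon=X)\to\mathbb P(\mathcal X_\star=X)$ for every $X\subseteq\{1,\dots,n\}$. Equivalently, if the columns of $Q\in\mathbb R^{n\times m}$ form an orthonormal basis of the column span of $V_{\le k}$, then $|DPP|_m(V_{\le k}V_{\le k}^\top)=|DPP|_m(QQ^\top)$, so $|DPP|_m(L_\varepsilon)$ converges to $|DPP|_m(QQ^\top)$; and this limit is the projection DPP with marginal kernel $QQ^\top$, i.e. $\mathbb P(A\subseteq\mathcal X_\star)=\det (QQ^\top)_A$ for every $A$. The limit is a discrete orthogonal-polynomial ensemble: there are polynomials $p_1,\dots,p_m$ of total degree at most $k$ with $\sum_i p_a(x_i)p_b(x_i)=\delta_{ab}$ such that $\mathbb P(\mathcal X_\star=X)=\det\big[\sum_a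 p_a(x_i)p_a(x_j)\big]_{i,j\in X}$ for $|X|=m$, and $0$ otherwise. -/

import Mathlib

open Filter Topology

noncomputable section

namespace FlatLimit

/-! ### Kernels -/

/-- A real kernel is positive definite if all its matrices `[κ (y i) (y j)]` at finitely many
points are (symmetric and) positive semi-definite. -/
def IsPositiveDefiniteKernel {S : Type*} (κ : S → S → ℝ) : Prop :=
  ∀ (N : ℕ) (y : Fin N → S), (Matrix.of fun i j => κ (y i) (y j)).PosSemidef

/-- `κ` is a stationary (radial) kernel on `ℝ^d` with profile `f`: it is positive definite,
`κ x y = f ‖x - y‖` for the Euclidean norm, and `f` is analytic at `0`. -/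
structure IsStationaryKernel {d : ℕ}
    (κ : EuclideanSpace ℝ (Fin d) → EuclideanSpace ℝ (Fin d) → ℝ) (f : ℝ → ℝ) : Prop where
  posDef : IsPositiveDefiniteKernel κ
  radial : ∀ x y, κ x y = f ‖x - y‖
  analytic : AnalyticAt ℝ f 0

/-- The rescaled derivative `f_i = f^{(i)}(0) / i!`. -/
def taylorCoeff (f : ℝ → ℝ) (i : ℕ) : ℝ :=
  iteratedDeriv i f 0 / (i.factorial : ℝ)

/-- The smoothness order: the least `r ≥ 1` with `f_{2r-1} ≠ 0`, and `⊤` if there is none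
(completely smooth kernels). -/
def smoothnessOrder (f : ℝ → ℝ) : ℕ∞ :=
  sInf {s : ℕ∞ | ∃ r : ℕ, 1 ≤ r ∧ taylorCoeff f (2 * r - 1) ≠ 0 ∧ s = (r : ℕ∞)}

/-- The kernel matrix `L_ε = [κ (ε x_i) (ε x_j)]` at inverse scale `ε`; for a stationary kernel
with profile `f` and `ε > 0` its entries are `f (ε ‖x_i - x_j‖)`. -/
def kernelMatrix {d n : ℕ} (κ : EuclideanSpace ℝ (Fin d) → EuclideanSpace ℝ (Fin d) → ℝ)
    (x : Fin n → EuclideanSpace ℝ (Fin d)) (ε : ℝ) : Matrix (Fin n) (Fin n) ℝ :=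
  Matrix.of fun i j => κ (ε • x i) (ε • x j)

/-! ### Monomials, Vandermonde matrix, Wronskian matrix -/

/-- The multi-indices `α ∈ ℕ^d` with `|α| ≤ k`. -/
def multiIndices (d k : ℕ) : Finset (Fin d → ℕ) :=
  (Fintype.piFinset fun _ => Finset.range (k + 1)).filter fun α => ∑ i, α i ≤ k

theorem mem_multiIndices {d k : ℕ} {α : Fin d → ℕ} :
    α ∈ multiIndices d k ↔ ∑ i, α i ≤ k := by
  simp only [multiIndices, Finset.mem_filter, Fintype.mem_piFinset, Finset.mem_range,
    and_iff_right_iff_imp]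
  intro h i
  have := Finset.single_le_sum (f := α) (fun j _ => Nat.zero_le _) (Finset.mem_univ i)
  omega

/-- `P_{k,d}`, the dimension of the space of polynomials of degree at most `k` in `d`
variables. -/
def polyDim (k d : ℕ) : ℕ := (k + d).choose d

/-- The multivariate Vandermonde matrix `V_{≤ k}`: rows indexed by the points, columns by the
monomials of degree at most `k`. -/
def vandermonde {d n : ℕ} (k : ℕ) (x : Fin n → EuclideanSpace ℝ (Fin d)) :
    Matrix (Fin n) (multiIndices d k) ℝ :=
  Matrix.of fun i α => ∏ l, x i l ^ α.1 l

/-- The partial derivative `∂g/∂x_i`. -/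
def partialDeriv {d : ℕ} (i : Fin d) (g : EuclideanSpace ℝ (Fin d) → ℝ) :
    EuclideanSpace ℝ (Fin d) → ℝ :=
  fun x => lineDeriv ℝ g x (EuclideanSpace.single i 1)

/-- The iterated partial derivative `g^{(α)} = ∂^{|α|} g / ∂x_1^{α_1} ⋯ ∂x_d^{α_d}`. -/
def multiDeriv {d : ℕ} (α : Fin d → ℕ) (g : EuclideanSpace ℝ (Fin d) → ℝ) :
    EuclideanSpace ℝ (Fin d) → ℝ :=
  (List.finRange d).foldr (fun i h => (partialDeriv i)^[α i] h) g

/-- The Wronskian matrix `W_{≤ k} = [κ^{(α,β)}(0,0) / (α! β!)]`, `|α| ≤ k`, `|β| ≤ k`, where `α`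
counts derivatives in the first argument and `β` those in the second. -/
def wronskian {d : ℕ} (k : ℕ)
    (κ : EuclideanSpace ℝ (Fin d) → EuclideanSpace ℝ (Fin d) → ℝ) :
    Matrix (multiIndices d k) (multiIndices d k) ℝ :=
  Matrix.of fun α β =>
    multiDeriv α.1 (fun x => multiDeriv β.1 (fun y => κ x y) 0) 0 /
      ((∏ i, ((α.1 i).factorial : ℝ)) * ∏ i, ((β.1 i).factorial : ℝ))

/-! ### Laws of random subsets of the ground set, determinantal point processes -/

/-- The principal minor `det L_X`. -/
def principalMinor {n : ℕ} (L : Matrix (Fin n) (Fin n) ℝ) (X : Finset (Fin n)) : ℝ :=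
  (L.submatrix (fun i : X => (i : Fin n)) (fun i : X => (i : Fin n))).det

/-- The mass function of the fixed-size L-ensemble `|DPP|_m(L)`:
`X ↦ det L_X / ∑_{|Y| = m} det L_Y` if `|X| = m`, and `0` otherwise. -/
def fixedSizeDPP {n : ℕ} (m : ℕ) (L : Matrix (Fin n) (Fin n) ℝ) (X : Finset (Fin n)) : ℝ :=
  if X.card = m then
    principalMinor L X / ∑ Y ∈ Finset.powersetCard m Finset.univ, principalMinor L Y
  else 0

/-- `P` is the mass function of a random subset of the ground set. -/
def IsMassFunction {n : ℕ} (P : Finset (Fin n) → ℝ) : Prop :=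
  (∀ X, 0 ≤ P X) ∧ ∑ X, P X = 1

/-- The random subset with mass function `P` is a determinantal point process with marginal
kernel `K`: `0 ≼ K ≼ I` and `ℙ(A ⊆ 𝒳) = det K_A` for all `A`. -/
def IsDPPWithMarginalKernel {n : ℕ} (P : Finset (Fin n) → ℝ) (K : Matrix (Fin n) (Fin n) ℝ) :
    Prop :=
  K.PosSemidef ∧ (1 - K).PosSemidef ∧
    ∀ A : Finset (Fin n), ∑ X ∈ Finset.univ.filter (fun X => A ⊆ X), P X = principalMinor K A

/-- The columns of `Q` are an orthonormal basis of the column span of `V`. -/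
def IsOrthonormalBasisOfSpan {n : ℕ} {ι ι' : Type*} [DecidableEq ι]
    (Q : Matrix (Fin n) ι ℝ) (V : Matrix (Fin n) ι' ℝ) : Prop :=
  Q.transpose * Q = 1 ∧
    Submodule.span ℝ (Set.range Q.transpose) = Submodule.span ℝ (Set.range V.transpose)

/-- The discrete orthogonal-polynomial ensemble of degree `k` on the points `x`: for some
polynomials `p_a` of degree at most `k`, `P_{k,d}` in number, orthonormal for the counting measure
on the points, the sets of size `P_{k,d}` have mass `det [∑_a p_a(x_i) p_a(x_j)]_{i,j ∈ X}` and
all others have mass zero. -/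
def IsDiscreteOrthogonalPolynomialEnsemble {d n : ℕ} (k : ℕ)
    (x : Fin n → EuclideanSpace ℝ (Fin d)) (P : Finset (Fin n) → ℝ) : Prop :=
  ∃ p : Fin (polyDim k d) → MvPolynomial (Fin d) ℝ,
    (∀ a, (p a).totalDegree ≤ k) ∧
    (∀ a b, ∑ i, MvPolynomial.eval (fun l => x i l) (p a) *
      MvPolynomial.eval (fun l => x i l) (p b) = if a = b then 1 else 0) ∧
    ∀ X, P X = if X.card = polyDim k d then
      principalMinor (Matrix.of fun i j => ∑ a, MvPolynomial.eval (fun l => x i l) (p a) *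
        MvPolynomial.eval (fun l => x j l) (p a)) X else 0

end FlatLimit

end

noncomputable section

namespace FlatLimit

open Matrix

/-! ### Determinants of products of rectangular matrices -/

/-! Put `t = √ε`. Since `k ≤ r - 1`, the odd Taylor coefficients of `f` of order below `2k` vanish,
so `f (ε‖x_i - x_j‖)` is a polynomial of degree at most `2k` in the coordinates of `ε(x_i - x_j)`,
plus `ε^(2k+1)` times a bounded term. Expanding in monomials `x_i^α x_j^β`, each carrying
`ε^(|α|+|β|)`, gives `L_ε = [V I] D_t diag(W, E_t) D_t [V I]ᵀ`, where `D_t` is diagonal with entries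
`t^(2|α|)` on monomials and `t^(2k+1)` on the remainder, and `E_t` converges.

By Cauchy–Binet, a minor of size `m` is a sum over pairs of choices of `m` indices, weighted by
powers of `t`. Exactly `m = P_{k,d}` indices have weight at most `2k`, namely the monomials with
`|α| ≤ k`. This is the unique lightest choice, and its block of `W` is the Wronskian matrix. Thus
every minor of size `m`, divided by one common power of `t`, tends to `det W_{≤k} · det (V_{≤k}
V_{≤k}ᵀ)_X` (`tendsto_det_graded_div`, `tendsto_principalMinor_kernelMatrix_div`). Normalisation
cancels the power of `t` and `det W_{≤k}`.

Two points need separate work. The radial function need not be smooth at the origin, so identifying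
the Wronskian entries with Taylor coefficients uses a class of remainders stable under
differentiation (`IsRadialRemainder`, `wronskian_eq_diffCoeff`). The marginal kernel of the limit is
found by computing the probabilities of avoiding a set in two ways and inverting inclusion-exclusion
(`isDPPWithMarginalKernel_fixedSizeDPP`). -/

/-- Cauchy–Binet summed over maps instead of subsets: non-injective maps contribute zero and each
subset is hit once per ordering, whence the factorial. This form needs no order on the indices. -/
theorem factorial_card_mul_det_mul {m N : Type*} [Fintype m] [DecidableEq m] [Fintype N]
    (A : Matrix m N ℝ) (B : Matrix N m ℝ) :
    ((Fintype.card m).factorial : ℝ) * (A * B).det =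
      ∑ p : m → N, (A.submatrix id p).det * (B.submatrix p id).det := by
  classical
  have key : ∀ τ : Equiv.Perm m, (A * B).det = ∑ p : m → N,
      (A.submatrix id p).det * ((Equiv.Perm.sign τ : ℤ) * ∏ i, B (p (τ i)) i) := by
    intro τ
    have h1 : (A * B).det = ∑ p : m → N, (A.submatrix id p).det * ∏ i, B (p i) i := by
      simp only [det_apply', mul_apply, submatrix_apply, id, Finset.prod_univ_sum,
        Fintype.piFinset_univ, Finset.mul_sum, Finset.sum_mul]
      rw [Finset.sum_comm]
      refine Finset.sum_congr rfl fun p _ => Finset.sum_congr rfl fun σ _ => ?_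
      rw [Finset.prod_mul_distrib]; ring
    rw [h1]
    have h2 : ∀ p : m → N, (A.submatrix id (p ∘ τ)).det =
        (Equiv.Perm.sign τ : ℤ) * (A.submatrix id p).det := by
      intro p
      have := det_permute' τ (A.submatrix id p)
      simpa [submatrix_submatrix] using this
    -- The substitution `p ↦ p ∘ τ` turns the multilinear expansion into one version per
    -- permutation; summing these over `τ` rebuilds the determinant of the rows of `B`.
    rw [← (Equiv.arrowCongr τ (Equiv.refl N)).symm.sum_comp]
    refine Finset.sum_congr rfl fun p _ => ?_
    have h3 : (Equiv.arrowCongr τ (Equiv.refl N)).symm p = p ∘ τ := by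
      ext i; simp [Equiv.arrowCongr]
    rw [h3, h2]
    simp only [Function.comp]; ring
  have h4 : ((Fintype.card m).factorial : ℝ) * (A * B).det =
      ∑ τ : Equiv.Perm m, (A * B).det := by
    simp [Finset.sum_const, Fintype.card_perm]
  rw [h4, Finset.sum_congr rfl fun τ _ => key τ, Finset.sum_comm]
  refine Finset.sum_congr rfl fun p _ => ?_
  rw [← Finset.mul_sum]
  simp [det_apply', submatrix_apply]

theorem factorial_card_sq_mul_det_mul_mul_transpose {m N : Type*} [Fintype m] [DecidableEq m]
    [Fintype N] (T : Matrix m N ℝ) (M : Matrix N N ℝ) :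
    ((Fintype.card m).factorial : ℝ) ^ 2 * (T * M * Tᵀ).det =
      ∑ p : m → N, ∑ q : m → N,
        (T.submatrix id p).det * (T.submatrix id q).det * (M.submatrix p q).det := by
  rw [Matrix.mul_assoc, sq, mul_assoc, factorial_card_mul_det_mul, Finset.mul_sum]
  refine Finset.sum_congr rfl fun p _ => ?_
  have h : (M * Tᵀ).submatrix p id = M.submatrix p id * Tᵀ := by
    ext i j; simp [mul_apply]
  rw [h, mul_left_comm, factorial_card_mul_det_mul, Finset.mul_sum]
  refine Finset.sum_congr rfl fun q _ => ?_
  have h' : (Tᵀ.submatrix q id).det = (T.submatrix id q).det := by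
    rw [← det_transpose]; rfl
  rw [h', submatrix_submatrix]
  simp only [Function.comp_id, Function.id_comp]; ring

theorem det_submatrix_diagonal_mul_mul {m N : Type*} [Fintype m] [DecidableEq m]
    [Fintype N] [DecidableEq N] (M : Matrix N N ℝ) (v : N → ℝ) (p q : m → N) :
    ((diagonal v * M * diagonal v).submatrix p q).det =
      (∏ i, v (p i)) * (∏ i, v (q i)) * (M.submatrix p q).det := by
  have h : (diagonal v * M * diagonal v).submatrix p q =
      diagonal (v ∘ p) * M.submatrix p q * diagonal (v ∘ q) := by
    ext i j; simp
  rw [h, det_mul, det_mul, det_diagonal, det_diagonal]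
  simp only [Function.comp]; ring

/-- A set of indices of the same size as a sublevel set of the weight has at least the total
weight of that sublevel set. -/
theorem sum_weight_le {N : Type*} [Fintype N] [DecidableEq N] (wt : N → ℕ) (c : ℕ)
    (S : Finset N)
    (hS : S.card = (Finset.univ.filter fun a => wt a ≤ c).card) :
    ∑ a with wt a ≤ c, wt a ≤ ∑ a ∈ S, wt a ∧
      (∑ a ∈ S, wt a = ∑ a with wt a ≤ c, wt a → ∀ a ∈ S, wt a ≤ c) := by
  set S₀ := Finset.univ.filter fun a => wt a ≤ c with hS₀
  -- Exchange argument: equally many indices enter and leave; those entering weigh at least `c + 1`,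
  -- those leaving at most `c`.
  have hc : (S \ S₀).card = (S₀ \ S).card := by
    have h1 := Finset.card_sdiff_add_card_inter S S₀
    have h2 := Finset.card_sdiff_add_card_inter S₀ S
    rw [Finset.inter_comm] at h2
    omega
  have e1 := Finset.sum_inter_add_sum_sdiff S S₀ wt
  have e2 := Finset.sum_inter_add_sum_sdiff S₀ S wt
  rw [Finset.inter_comm] at e2
  have b1 : (S \ S₀).card * (c + 1) ≤ ∑ a ∈ S \ S₀, wt a := by
    rw [← smul_eq_mul]
    refine Finset.card_nsmul_le_sum _ _ _ fun a ha => ?_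
    have := (Finset.mem_sdiff.1 ha).2
    simp only [hS₀, Finset.mem_filter, Finset.mem_univ, true_and, not_le] at this
    omega
  have b2 : ∑ a ∈ S₀ \ S, wt a ≤ (S₀ \ S).card * c := by
    rw [← smul_eq_mul]
    refine Finset.sum_le_card_nsmul _ _ _ fun a ha => ?_
    have := (Finset.mem_sdiff.1 ha).1
    simpa [hS₀] using this
  rw [hc] at b1
  refine ⟨by nlinarith, fun h => ?_⟩
  have h0 : (S₀ \ S).card = 0 := by nlinarith
  rw [← hc, Finset.card_eq_zero] at h0
  intro a ha
  have := Finset.sdiff_eq_empty_iff_subset.1 h0 ha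
  simpa [hS₀] using this

/-- Asymptotics of a determinant with graded scaling: only the block of lowest weight
contributes. -/
theorem tendsto_det_graded_div {m N : Type*} [Fintype m] [DecidableEq m] [Fintype N]
    [DecidableEq N] (wt : N → ℕ) (c : ℕ)
    (hcard : Fintype.card m = (Finset.univ.filter fun a => wt a ≤ c).card)
    (T : Matrix m N ℝ) (M : ℝ → Matrix N N ℝ) (M' : Matrix N N ℝ)
    (hM : Tendsto M (𝓝[>] 0) (𝓝 M')) :
    Tendsto (fun t : ℝ =>
        (T * (diagonal (fun a => t ^ wt a) * M t * diagonal (fun a => t ^ wt a)) * Tᵀ).det /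
          t ^ (2 * ∑ a with wt a ≤ c, wt a)) (𝓝[>] 0)
      (𝓝 (T * (Matrix.of fun a b => if wt a ≤ c ∧ wt b ≤ c then M' a b else 0) * Tᵀ).det) := by
  set s := ∑ a with wt a ≤ c, wt a with hs
  set R : Matrix N N ℝ := Matrix.of fun a b => if wt a ≤ c ∧ wt b ≤ c then M' a b else 0 with hR
  have hF : (((Fintype.card m).factorial : ℝ) ^ 2) ≠ 0 := by positivity
  have hmul : Tendsto (fun t : ℝ => ((Fintype.card m).factorial : ℝ) ^ 2 *
        ((T * (diagonal (fun a => t ^ wt a) * M t * diagonal (fun a => t ^ wt a)) * Tᵀ).det /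
          t ^ (2 * s))) (𝓝[>] 0)
      (𝓝 (((Fintype.card m).factorial : ℝ) ^ 2 * (T * R * Tᵀ).det)) := by
    simp only [← mul_div_assoc, factorial_card_sq_mul_det_mul_mul_transpose, Finset.sum_div]
    refine tendsto_finsetSum _ fun p _ => tendsto_finsetSum _ fun q _ => ?_
    by_cases hp : Function.Injective p
    swap
    · have : (T.submatrix id p).det = 0 := by
        simp only [Function.Injective, not_forall] at hp
        obtain ⟨i, j, hij, hne⟩ := hp
        exact det_zero_of_column_eq hne fun l => by simp [hij]
      simp [this]
    by_cases hq : Function.Injective q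
    swap
    · have : (T.submatrix id q).det = 0 := by
        simp only [Function.Injective, not_forall] at hq
        obtain ⟨i, j, hij, hne⟩ := hq
        exact det_zero_of_column_eq hne fun l => by simp [hij]
      simp [this]
    -- The bound makes the natural-number subtractions of `s` below genuine; the equality case
    -- singles out the lightest choice.
    have hw : ∀ p : m → N, Function.Injective p → s ≤ ∑ i, wt (p i) ∧
        (∑ i, wt (p i) = s → ∀ i, wt (p i) ≤ c) := by
      intro p hp
      have := sum_weight_le wt c (Finset.univ.image p)
        (by rw [Finset.card_image_of_injective _ hp, ← hcard, Finset.card_univ])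
      rw [Finset.sum_image fun a _ b _ h => hp h] at this
      refine ⟨this.1, fun h i => this.2 h _ (Finset.mem_image_of_mem _ (Finset.mem_univ i))⟩
    obtain ⟨hp1, hp2⟩ := hw p hp
    obtain ⟨hq1, hq2⟩ := hw q hq
    have hdet : Tendsto (fun t => ((M t).submatrix p q).det) (𝓝[>] 0)
        (𝓝 (M'.submatrix p q).det) := by
      have hcont : Continuous fun A : Matrix N N ℝ => (A.submatrix p q).det := by fun_prop
      exact (hcont.tendsto M').comp hM
    have hpow : Tendsto
        (fun t : ℝ => t ^ ((∑ i, wt (p i) - s) + (∑ i, wt (q i) - s))) (𝓝[>] 0)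
        (𝓝 (0 ^ ((∑ i, wt (p i) - s) + (∑ i, wt (q i) - s)))) :=
      ((continuous_pow _).tendsto 0).mono_left nhdsWithin_le_nhds
    -- Here `0 ^ 0 = 1`, and every positive exponent gives `0`: only pairs `p`, `q` landing in the
    -- sublevel set survive, which is what cutting `M'` down to `R` expresses.
    have hlim : (T.submatrix id p).det * (T.submatrix id q).det *
        ((0 : ℝ) ^ ((∑ i, wt (p i) - s) + (∑ i, wt (q i) - s)) * (M'.submatrix p q).det) =
        (T.submatrix id p).det * (T.submatrix id q).det * (R.submatrix p q).det := by
      congr 1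
      by_cases h : (∀ i, wt (p i) ≤ c) ∧ (∀ i, wt (q i) ≤ c)
      · have e : ∀ p : m → N, Function.Injective p → (∀ i, wt (p i) ≤ c) →
            ∑ i, wt (p i) = s := by
          intro p hp h
          rw [hs]
          have : Finset.univ.image p = Finset.univ.filter fun a => wt a ≤ c := by
            refine Finset.eq_of_subset_of_card_le (fun a ha => ?_) ?_
            · obtain ⟨i, _, rfl⟩ := Finset.mem_image.1 ha
              simpa using h i
            · rw [Finset.card_image_of_injective _ hp, ← hcard, Finset.card_univ]
          rw [← this, Finset.sum_image fun a _ b _ h => hp h]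
        have : R.submatrix p q = M'.submatrix p q := by
          ext i j; simp [hR, h.1 i, h.2 j]
        rw [this, e p hp h.1, e q hq h.2]; simp
      · have hz : (R.submatrix p q).det = 0 := by
          rw [not_and_or] at h
          rcases h with h | h
          · push Not at h
            obtain ⟨i, hi⟩ := h
            refine det_eq_zero_of_row_eq_zero i fun j => ?_
            simp [hR, not_le.2 hi]
          · push Not at h
            obtain ⟨i, hi⟩ := h
            refine det_eq_zero_of_column_eq_zero i fun j => ?_
            simp [hR, not_le.2 hi]
        have : (∑ i, wt (p i) - s) + (∑ i, wt (q i) - s) ≠ 0 := by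
          intro h0
          exact h ⟨hp2 (by omega), hq2 (by omega)⟩
        rw [hz, zero_pow this, zero_mul]
    rw [← hlim]
    refine Tendsto.congr' ?_ ((hpow.mul hdet).const_mul _)
    filter_upwards [self_mem_nhdsWithin] with t ht
    have ht0 : t ≠ 0 := ne_of_gt ht
    rw [det_submatrix_diagonal_mul_mul, Finset.prod_pow_eq_pow_sum, Finset.prod_pow_eq_pow_sum,
      eq_div_iff (pow_ne_zero _ ht0)]
    have : t ^ (∑ i, wt (p i)) * t ^ (∑ i, wt (q i)) =
        t ^ ((∑ i, wt (p i) - s) + (∑ i, wt (q i) - s)) * t ^ (2 * s) := by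
      rw [← pow_add, ← pow_add]; congr 1; omega
    rw [this]; ring
  have := hmul.const_mul (((Fintype.card m).factorial : ℝ) ^ 2)⁻¹
  simpa only [inv_mul_cancel_left₀ hF] using this

end FlatLimit

/-! ### Linear algebra of fixed-size ensembles, independent of the kernel -/

namespace FlatLimit

open Matrix

/-! ### Principal minors and fixed-size L-ensembles -/

theorem coeff_det_one_add_X_smul {n : ℕ} (M : Matrix (Fin n) (Fin n) ℝ) (k : ℕ) :
    (1 + (Polynomial.X : Polynomial ℝ) • M.map Polynomial.C).det.coeff k =
      ∑ A ∈ Finset.powersetCard k Finset.univ, principalMinor M A :=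
  coeff_det_one_add_X_smul_eq_sum_minors M k

/-- Sylvester's identity equates `det (1 + X A Aᵀ)` with `det (1 + X Aᵀ A)`; the coefficient of
degree `card ι` on the right is the full determinant. This evaluates every normalising constant. -/
theorem sum_powersetCard_principalMinor_mul_transpose {n : ℕ} {ι : Type*} [Fintype ι]
    [DecidableEq ι] (A : Matrix (Fin n) ι ℝ) :
    ∑ Y ∈ Finset.powersetCard (Fintype.card ι) Finset.univ, principalMinor (A * Aᵀ) Y =
      (Aᵀ * A).det := by
  have hcomm : (1 + (Polynomial.X : Polynomial ℝ) • (A * Aᵀ).map Polynomial.C).det =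
      (1 + (Polynomial.X : Polynomial ℝ) • (Aᵀ * A).map Polynomial.C).det := by
    have e₁ : (Polynomial.X : Polynomial ℝ) • (A * Aᵀ).map Polynomial.C =
        ((Polynomial.X : Polynomial ℝ) • A.map Polynomial.C) * (Aᵀ.map Polynomial.C) := by
      rw [Matrix.smul_mul, Matrix.map_mul]
    have e₂ : (Polynomial.X : Polynomial ℝ) • (Aᵀ * A).map Polynomial.C =
        (Aᵀ.map Polynomial.C) * ((Polynomial.X : Polynomial ℝ) • A.map Polynomial.C) := by
      rw [Matrix.mul_smul, Matrix.map_mul]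
    rw [e₁, e₂, det_one_add_mul_comm]
  rw [← coeff_det_one_add_X_smul, hcomm, coeff_det_one_add_X_smul_eq_sum_minors,
    ← Finset.card_univ, Finset.powersetCard_self, Finset.sum_singleton]
  let e : (Finset.univ : Finset ι) ≃ ι := Equiv.subtypeUnivEquiv fun i => Finset.mem_univ i
  exact det_submatrix_equiv_self e (Aᵀ * A)

theorem det_one_add_eq_sum_principalMinor {n : ℕ} (M : Matrix (Fin n) (Fin n) ℝ) :
    (1 + M).det = ∑ A : Finset (Fin n), principalMinor M A := by
  set P := (1 + (Polynomial.X : Polynomial ℝ) • M.map Polynomial.C).det with hP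
  have h1 : (1 + M).det = P.eval 1 := by
    rw [hP, ← Polynomial.coe_evalRingHom, RingHom.map_det]
    congr 1
    ext i j
    by_cases hij : i = j <;> simp [hij]
  have hco : ∀ k, P.coeff k = ∑ A ∈ Finset.powersetCard k Finset.univ, principalMinor M A :=
    coeff_det_one_add_X_smul M
  have hdeg : P.natDegree < n + 1 := by
    rw [Nat.lt_succ_iff, Polynomial.natDegree_le_iff_coeff_eq_zero]
    intro N hN
    rw [hco, Finset.powersetCard_eq_empty.2 (by simpa using hN), Finset.sum_empty]
  rw [h1, Polynomial.eval_eq_sum_range' hdeg]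
  simp only [one_pow, mul_one, hco]
  rw [← Finset.powerset_univ, Finset.sum_powerset]
  simp

/-- When `|X|` equals the number of columns, the rows of `A` in `X` form a square matrix and the
determinant factors. Hence changing the inner matrix rescales all minors of this size alike. -/
theorem principalMinor_mul_mul_transpose {n : ℕ} {ι : Type*} [Fintype ι] [DecidableEq ι]
    (A : Matrix (Fin n) ι ℝ) (B : Matrix ι ι ℝ) {X : Finset (Fin n)}
    (hX : X.card = Fintype.card ι) :
    principalMinor (A * B * Aᵀ) X = B.det * principalMinor (A * Aᵀ) X := by
  have e : ι ≃ X := Fintype.equivOfCardEq (by simp [hX])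
  unfold principalMinor
  have key : ∀ B : Matrix ι ι ℝ,
      ((A * B * Aᵀ).submatrix (fun i : X => (i : Fin n)) (fun i : X => (i : Fin n))).det =
      B.det * (A.submatrix (fun i => (e i : Fin n)) id).det ^ 2 := by
    intro B
    rw [← det_submatrix_equiv_self e]
    have : ((A * B * Aᵀ).submatrix (fun i : X => (i : Fin n))
        (fun i : X => (i : Fin n))).submatrix e e =
        A.submatrix (fun i => (e i : Fin n)) id * B *
          (A.submatrix (fun i => (e i : Fin n)) id)ᵀ := by
      ext i j; simp [mul_apply]
    rw [this, det_mul, det_mul, det_transpose]; ring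
  have := key 1
  rw [Matrix.mul_one, det_one, one_mul] at this
  rw [key, this]

theorem principalMinor_diagonal_mul_mul {n : ℕ} (M : Matrix (Fin n) (Fin n) ℝ)
    (z : Fin n → ℝ) (X : Finset (Fin n)) :
    principalMinor (diagonal z * M * diagonal z) X =
      (∏ i ∈ X, z i) ^ 2 * principalMinor M X := by
  unfold principalMinor
  rw [det_submatrix_diagonal_mul_mul, ← sq, Finset.prod_coe_sort X z]

theorem principalMinor_neg {n : ℕ} (M : Matrix (Fin n) (Fin n) ℝ) (X : Finset (Fin n)) :
    principalMinor (-M) X = (-1) ^ X.card * principalMinor M X := by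
  unfold principalMinor
  rw [submatrix_neg, Pi.neg_apply, Pi.neg_apply, det_neg, Fintype.card_coe]

theorem _root_.Matrix.PosSemidef.principalMinor_nonneg {n : ℕ} {L : Matrix (Fin n) (Fin n) ℝ}
    (hL : L.PosSemidef) (X : Finset (Fin n)) : 0 ≤ principalMinor L X :=
  (hL.submatrix _).det_nonneg

theorem posSemidef_mul_transpose {n : ℕ} {ι : Type*} [Fintype ι] (A : Matrix (Fin n) ι ℝ) :
    (A * Aᵀ).PosSemidef := by
  simpa [conjTranspose_eq_transpose_of_trivial] using posSemidef_self_mul_conjTranspose A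

theorem isMassFunction_fixedSizeDPP {n : ℕ} (m : ℕ) {L : Matrix (Fin n) (Fin n) ℝ}
    (hL : L.PosSemidef)
    (h0 : ∑ Y ∈ Finset.powersetCard m Finset.univ, principalMinor L Y ≠ 0) :
    IsMassFunction (fixedSizeDPP m L) := by
  constructor
  · intro X
    unfold fixedSizeDPP
    split_ifs
    · exact div_nonneg (hL.principalMinor_nonneg X)
        (Finset.sum_nonneg fun Y _ => hL.principalMinor_nonneg Y)
    · exact le_rfl
  · unfold fixedSizeDPP
    rw [← Finset.sum_filter, ← Finset.sum_div]
    have : Finset.univ.filter (fun X : Finset (Fin n) => X.card = m) =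
        Finset.powersetCard m Finset.univ := by
      ext X; simp [Finset.mem_powersetCard]
    rw [this, div_self h0]

theorem fixedSizeDPP_congr_of_smul {n m : ℕ} {L L' : Matrix (Fin n) (Fin n) ℝ} {c : ℝ}
    (hc : c ≠ 0) (h : ∀ X : Finset (Fin n), X.card = m →
      principalMinor L X = c * principalMinor L' X) :
    fixedSizeDPP m L = fixedSizeDPP m L' := by
  funext X
  unfold fixedSizeDPP
  split_ifs with hX
  · rw [h X hX, Finset.sum_congr rfl fun Y hY => h Y (Finset.mem_powersetCard.1 hY).2,
      ← Finset.mul_sum, mul_div_mul_left _ _ hc]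
  · rfl

/-! ### Inclusion-exclusion -/

/-- After exchanging sums, `X` is weighted by the alternating sum over subsets of `X ∩ C`, which
vanishes unless that intersection is empty. -/
theorem sum_powerset_neg_one_pow_mul_sum_superset {α : Type*} [Fintype α] [DecidableEq α]
    (P : Finset α → ℝ) (C : Finset α) :
    ∑ A ∈ C.powerset, (-1 : ℝ) ^ A.card * ∑ X with A ⊆ X, P X =
      ∑ X with Disjoint X C, P X := by
  simp only [Finset.mul_sum, Finset.sum_filter, mul_ite, mul_zero]
  rw [Finset.sum_comm]
  refine Finset.sum_congr rfl fun X _ => ?_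
  rw [← Finset.sum_filter, ← Finset.sum_mul]
  have : C.powerset.filter (fun A => A ⊆ X) = (X ∩ C).powerset := by
    ext A
    rw [Finset.mem_filter, Finset.mem_powerset, Finset.mem_powerset, Finset.subset_inter_iff,
      and_comm]
  have h := congrArg (Int.cast : ℤ → ℝ) (Finset.sum_powerset_neg_one_pow_card (x := X ∩ C))
  push_cast at h
  rw [this, h]
  simp [Finset.disjoint_iff_inter_eq_empty]

/-- Möbius inversion on the subset lattice: in the sum for `C`, all terms except `A = C` are known
by induction. -/
theorem eq_of_alternating_sums_eq {α : Type*} [DecidableEq α]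
    {F G : Finset α → ℝ}
    (h : ∀ C : Finset α, ∑ A ∈ C.powerset, (-1 : ℝ) ^ A.card * F A =
      ∑ A ∈ C.powerset, (-1 : ℝ) ^ A.card * G A) : F = G := by
  funext C
  induction C using Finset.strongInduction with
  | H C ih =>
    have hC := h C
    rw [← Finset.add_sum_erase _ _ (Finset.mem_powerset_self C),
      ← Finset.add_sum_erase _ _ (Finset.mem_powerset_self C)] at hC
    have : ∑ A ∈ C.powerset.erase C, (-1 : ℝ) ^ A.card * F A =
        ∑ A ∈ C.powerset.erase C, (-1 : ℝ) ^ A.card * G A := by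
      refine Finset.sum_congr rfl fun A hA => ?_
      rw [Finset.mem_erase, Finset.mem_powerset] at hA
      rw [ih A (Finset.ssubset_iff_subset_ne.2 ⟨hA.2, hA.1⟩)]
    rw [this, add_left_inj] at hC
    exact mul_left_cancel₀ (pow_ne_zero _ (by norm_num)) hC

/-! ### Projection determinantal point processes -/

theorem fixedSizeDPP_mul_transpose_of_orthonormal {n m : ℕ} {Q : Matrix (Fin n) (Fin m) ℝ}
    (hQ : Qᵀ * Q = 1) (X : Finset (Fin n)) :
    fixedSizeDPP m (Q * Qᵀ) X = if X.card = m then principalMinor (Q * Qᵀ) X else 0 := by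
  have h := sum_powersetCard_principalMinor_mul_transpose Q
  rw [Fintype.card_fin, hQ, det_one] at h
  unfold fixedSizeDPP
  rw [h, div_one]

/-- `1 - Q Qᵀ` is a symmetric idempotent, hence equal to its product with its own transpose. -/
theorem posSemidef_one_sub_mul_transpose {n m : ℕ} {Q : Matrix (Fin n) (Fin m) ℝ}
    (hQ : Qᵀ * Q = 1) : (1 - Q * Qᵀ).PosSemidef := by
  have h : (1 - Q * Qᵀ) = (1 - Q * Qᵀ) * (1 - Q * Qᵀ)ᵀ := by
    have : Q * Qᵀ * (Q * Qᵀ) = Q * Qᵀ := by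
      rw [Matrix.mul_assoc, ← Matrix.mul_assoc Qᵀ, hQ, Matrix.one_mul]
    rw [transpose_sub, transpose_one, transpose_mul, transpose_transpose, Matrix.mul_sub,
      Matrix.mul_one, Matrix.sub_mul,
      Matrix.one_mul, this, sub_self, sub_zero]
  rw [h]
  exact posSemidef_mul_transpose _

/-- Both sides have the same alternating sums over subsets of `C`. With `D`, `D'` the coordinate
projections off and onto `C`, the probability of avoiding `C` is `det (Qᵀ D Q) = det (1 - Qᵀ D' Q) =
det (1 - D' Q Qᵀ D')`, and the last determinant is the alternating sum of the minors of `Q Qᵀ`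
inside `C`. -/
theorem isDPPWithMarginalKernel_fixedSizeDPP {n m : ℕ} {Q : Matrix (Fin n) (Fin m) ℝ}
    (hQ : Qᵀ * Q = 1) : IsDPPWithMarginalKernel (fixedSizeDPP m (Q * Qᵀ)) (Q * Qᵀ) := by
  refine ⟨posSemidef_mul_transpose Q, posSemidef_one_sub_mul_transpose hQ, ?_⟩
  refine congrFun (eq_of_alternating_sums_eq (F := fun A => ∑ X with A ⊆ X, _) fun C => ?_)
  rw [sum_powerset_neg_one_pow_mul_sum_superset]
  set z : Fin n → ℝ := fun i => if i ∈ C then 0 else 1 with hz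
  set z' : Fin n → ℝ := fun i => if i ∈ C then 1 else 0 with hz'
  have hzz : diagonal z * diagonal z = 1 - diagonal z' * diagonal z' := by
    rw [diagonal_mul_diagonal, diagonal_mul_diagonal, ← diagonal_one, diagonal_sub]
    congr 1
    funext i
    by_cases hi : i ∈ C <;> simp [hz, hz', hi]
  -- Scaling by `z` kills exactly the minors of sets meeting `C`.
  have h1 : ∑ X with Disjoint X C, fixedSizeDPP m (Q * Qᵀ) X =
      ((diagonal z * Q)ᵀ * (diagonal z * Q)).det := by
    rw [← sum_powersetCard_principalMinor_mul_transpose, Fintype.card_fin]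
    have hp : Finset.powersetCard m Finset.univ =
        Finset.univ.filter (fun X : Finset (Fin n) => X.card = m) := by
      ext X; simp [Finset.mem_powersetCard]
    rw [hp, Finset.sum_filter, Finset.sum_filter]
    refine Finset.sum_congr rfl fun X _ => ?_
    rw [fixedSizeDPP_mul_transpose_of_orthonormal hQ, transpose_mul, diagonal_transpose,
      ← Matrix.mul_assoc, Matrix.mul_assoc (diagonal z), principalMinor_diagonal_mul_mul]
    by_cases hd : Disjoint X C
    · have : ∏ i ∈ X, z i = 1 :=
        Finset.prod_eq_one fun i hi => by simp [hz, Finset.disjoint_left.1 hd hi]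
      simp [hd, this]
    · have : ∏ i ∈ X, z i = 0 := by
        obtain ⟨i, hi, hi'⟩ := Finset.not_disjoint_iff.1 hd
        exact Finset.prod_eq_zero hi (by simp [hz, hi'])
      simp [hd, this]
  have h2 : ((diagonal z * Q)ᵀ * (diagonal z * Q)).det =
      (1 + -(diagonal z' * (Q * Qᵀ) * diagonal z')).det := by
    have e : (diagonal z * Q)ᵀ * (diagonal z * Q) =
        1 - (diagonal z' * Q)ᵀ * (diagonal z' * Q) := by
      have : ∀ D : Fin n → ℝ, (diagonal D * Q)ᵀ * (diagonal D * Q) =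
          Qᵀ * (diagonal D * diagonal D) * Q := by
        intro D
        simp only [transpose_mul, diagonal_transpose, Matrix.mul_assoc]
      rw [this, this, hzz, Matrix.mul_sub, Matrix.sub_mul, Matrix.mul_one, hQ]
    rw [e, det_one_sub_mul_comm, ← sub_eq_add_neg, transpose_mul, diagonal_transpose]
    simp only [Matrix.mul_assoc]
  rw [h1, h2, det_one_add_eq_sum_principalMinor]
  symm
  rw [← Finset.filter_subset_univ, Finset.sum_filter]
  refine Finset.sum_congr rfl fun A _ => ?_
  rw [principalMinor_neg, principalMinor_diagonal_mul_mul]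
  by_cases hA : A ⊆ C
  · have : ∏ i ∈ A, z' i = 1 := Finset.prod_eq_one fun i hi => by simp [hz', hA hi]
    simp [hA, this]
  · have : ∏ i ∈ A, z' i = 0 := by
      obtain ⟨i, hi, hi'⟩ := Finset.not_subset.1 hA
      exact Finset.prod_eq_zero hi (by simp [hz', hi'])
    simp [hA, this]

/-! ### Orthonormal bases of column spans -/

theorem exists_eq_mul_of_span_le {n : ℕ} {ι ι' : Type*} [Fintype ι]
    {A : Matrix (Fin n) ι ℝ} {B : Matrix (Fin n) ι' ℝ}
    (h : Submodule.span ℝ (Set.range Bᵀ) ≤ Submodule.span ℝ (Set.range Aᵀ)) :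
    ∃ C : Matrix ι ι' ℝ, B = A * C := by
  have : ∀ j, ∃ c : ι → ℝ, ∑ i, c i • Aᵀ i = Bᵀ j := fun j =>
    (Submodule.mem_span_range_iff_exists_fun ℝ).1 (h (Submodule.subset_span ⟨j, rfl⟩))
  choose c hc using this
  refine ⟨Matrix.of fun i j => c j i, ?_⟩
  ext i j
  have := congrFun (hc j) i
  simp only [Finset.sum_apply, Pi.smul_apply, smul_eq_mul, transpose_apply] at this
  rw [← this, mul_apply]
  exact Finset.sum_congr rfl fun l _ => mul_comm _ _

theorem det_transpose_mul_self_ne_zero {n : ℕ} {ι : Type*} [Fintype ι] [DecidableEq ι]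
    {A : Matrix (Fin n) ι ℝ} (hA : A.rank = Fintype.card ι) : (Aᵀ * A).det ≠ 0 := by
  rw [← rank_transpose_mul_self] at hA
  have h := linearIndependent_rows_iff_isUnit (A := Aᵀ * A)
  have : LinearIndependent ℝ (Aᵀ * A).row := by
    rw [linearIndependent_iff_card_eq_finrank_span, ← hA, rank_eq_finrank_span_row]
    rfl
  exact ((isUnit_iff_isUnit_det _).1 (h.1 this)).ne_zero

/-- The column span is moved to `EuclideanSpace`, where an inner product is available, and the span
of the resulting basis is moved back. -/
theorem exists_isOrthonormalBasisOfSpan {n m : ℕ} {ι : Type*} [Fintype ι]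
    (V : Matrix (Fin n) ι ℝ) (hV : V.rank = m) :
    ∃ Q : Matrix (Fin n) (Fin m) ℝ, IsOrthonormalBasisOfSpan Q V := by
  set e := (WithLp.linearEquiv 2 ℝ (Fin n → ℝ)) with he
  set S := Submodule.span ℝ (Set.range Vᵀ) with hS
  set S' : Submodule ℝ (EuclideanSpace ℝ (Fin n)) := S.map e.symm.toLinearMap
    with hS'
  have hfin : Module.finrank ℝ S' = m := by
    rw [hS', LinearEquiv.finrank_map_eq, ← hV, rank_eq_finrank_span_cols]
    rfl
  let b := (stdOrthonormalBasis ℝ S').reindex (finCongr hfin)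
  refine ⟨Matrix.of fun i a => (b a : EuclideanSpace ℝ (Fin n)) i, ?_, ?_⟩
  · ext a c
    have := (orthonormal_iff_ite.1 b.orthonormal) a c
    rw [Submodule.coe_inner, PiLp.inner_apply] at this
    rw [mul_apply, one_apply, ← this]
    refine Finset.sum_congr rfl fun i _ => ?_
    simp [mul_comm]
  · have h1 : Submodule.span ℝ (Set.range fun a => (b a : EuclideanSpace ℝ (Fin n))) = S' := by
      have := congrArg (Submodule.map S'.subtype) b.toBasis.span_eq
      rw [Submodule.map_span, Submodule.map_top, Submodule.range_subtype, ← Set.range_comp]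
        at this
      simpa [Function.comp_def] using this
    have h2 := congrArg (Submodule.map e.toLinearMap) h1
    rw [Submodule.map_span, ← Set.range_comp] at h2
    have h4 : S'.map e.toLinearMap = S.map (e.toLinearMap ∘ₗ e.symm.toLinearMap) :=
      (Submodule.map_comp _ _ _).symm
    have h3 : e.toLinearMap ∘ₗ
        e.symm.toLinearMap = LinearMap.id := by
      ext; simp
    rw [h4, h3, Submodule.map_id] at h2
    rw [← hS, ← h2]
    rfl

/-- Writing `V = Q C`, all minors of size `m` differ by the factor `det (C Cᵀ)`. It is nonzero,
since otherwise these minors of `V Vᵀ` would all vanish, while they sum to the nonzero Gram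
determinant of `V`. -/
theorem fixedSizeDPP_eq_of_isOrthonormalBasisOfSpan {n m : ℕ} {ι : Type*} [Fintype ι]
    [DecidableEq ι] {V : Matrix (Fin n) ι ℝ} {Q : Matrix (Fin n) (Fin m) ℝ}
    (hcard : Fintype.card ι = m) (hV : V.rank = m) (hQ : IsOrthonormalBasisOfSpan Q V) :
    fixedSizeDPP m (V * Vᵀ) = fixedSizeDPP m (Q * Qᵀ) := by
  obtain ⟨C, hC⟩ := exists_eq_mul_of_span_le hQ.2.ge
  have hm : ∀ X : Finset (Fin n), X.card = m →
      principalMinor (V * Vᵀ) X = (C * Cᵀ).det * principalMinor (Q * Qᵀ) X := by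
    intro X hX
    rw [← principalMinor_mul_mul_transpose Q (C * Cᵀ) (by simpa using hX)]
    congr 1
    simp only [hC, transpose_mul, Matrix.mul_assoc]
  refine fixedSizeDPP_congr_of_smul (fun h0 => ?_) hm
  have h1 := sum_powersetCard_principalMinor_mul_transpose V
  rw [hcard] at h1
  refine det_transpose_mul_self_ne_zero (hV.trans hcard.symm) (h1.symm.trans ?_)
  exact Finset.sum_eq_zero fun Y hY => by
    rw [hm Y (Finset.mem_powersetCard.1 hY).2, h0, zero_mul]

end FlatLimit

/-! ### Derivatives at the origin of radial functions of limited smoothness -/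

namespace FlatLimit

open Asymptotics

/-! ### Line derivatives of polynomials and radial functions -/

theorem hasLineDerivAt_eval {d : ℕ} (q : MvPolynomial (Fin d) ℝ) (i : Fin d)
    (z : EuclideanSpace ℝ (Fin d)) :
    HasLineDerivAt ℝ (fun z : EuclideanSpace ℝ (Fin d) => MvPolynomial.eval (fun l => z l) q)
      (MvPolynomial.eval (fun l => z l) (MvPolynomial.pderiv i q)) z
      (EuclideanSpace.single i 1) := by
  unfold HasLineDerivAt
  induction q using MvPolynomial.induction_on with
  | C a => simpa using hasDerivAt_const (0 : ℝ) a
  | add p q hp hq =>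
    simp only [map_add]
    exact hp.add hq
  | mul_X p j hp =>
    have hX : HasDerivAt (fun t : ℝ => (z + t • EuclideanSpace.single i (1 : ℝ)) j)
        ((EuclideanSpace.single i (1 : ℝ)) j) 0 := by
      have := ((hasDerivAt_id (0 : ℝ)).mul_const
        ((EuclideanSpace.single i (1 : ℝ)) j)).const_add (z j)
      simpa using this
    have := hp.mul hX
    simp only [map_mul, MvPolynomial.eval_X]
    refine this.congr_deriv ?_
    by_cases hij : i = j
    · subst hij; simp; ring
    · simp [MvPolynomial.pderiv_X_of_ne (Ne.symm hij), Ne.symm hij, mul_comm]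

theorem hasLineDerivAt_norm {d : ℕ} (i : Fin d) {z : EuclideanSpace ℝ (Fin d)} (hz : z ≠ 0) :
    HasLineDerivAt ℝ (fun z : EuclideanSpace ℝ (Fin d) => ‖z‖) (z i / ‖z‖) z
      (EuclideanSpace.single i 1) := by
  have hline : HasDerivAt (fun t : ℝ => z + t • EuclideanSpace.single i (1 : ℝ))
      (EuclideanSpace.single i (1 : ℝ)) 0 := by
    simpa using ((hasDerivAt_id (0 : ℝ)).smul_const
      (EuclideanSpace.single i (1 : ℝ))).const_add z
  have h2 := hline.norm_sq.sqrt (by simpa using hz)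
  unfold HasLineDerivAt
  simp only [Real.sqrt_sq (norm_nonneg _), zero_smul, add_zero] at h2
  refine h2.congr_deriv ?_
  rw [mul_div_mul_left _ _ two_ne_zero]
  simp [EuclideanSpace.inner_single_right]

theorem HasLineDerivAt.comp_hasDerivAt_norm {d : ℕ} (i : Fin d)
    {z : EuclideanSpace ℝ (Fin d)} (hz : z ≠ 0) {ψ : ℝ → ℝ} {ψ' : ℝ}
    (hψ : HasDerivAt ψ ψ' ‖z‖) :
    HasLineDerivAt ℝ (fun z : EuclideanSpace ℝ (Fin d) => ψ ‖z‖) (ψ' * (z i / ‖z‖)) z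
      (EuclideanSpace.single i 1) := by
  have h := hasLineDerivAt_norm i hz
  unfold HasLineDerivAt at h ⊢
  refine HasDerivAt.comp (0 : ℝ) (h₂ := ψ) ?_ h
  simpa using hψ

theorem abs_eval_le_of_isHomogeneous {d a : ℕ} {q : MvPolynomial (Fin d) ℝ}
    (hq : q.IsHomogeneous a) (z : EuclideanSpace ℝ (Fin d)) :
    |MvPolynomial.eval (fun l => z l) q| ≤ (∑ s ∈ q.support, |q.coeff s|) * ‖z‖ ^ a := by
  rw [MvPolynomial.eval_eq', Finset.sum_mul]
  refine (Finset.abs_sum_le_sum_abs _ _).trans (Finset.sum_le_sum fun s hs => ?_)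
  rw [abs_mul, Finset.abs_prod]
  refine mul_le_mul_of_nonneg_left ?_ (abs_nonneg _)
  have hdeg : ∑ l, s l = a := by
    rw [hq.degree_eq_sum_deg_support hs, ← Finsupp.degree_eq_sum]; rfl
  rw [← hdeg, ← Finset.prod_pow_eq_pow_sum]
  refine Finset.prod_le_prod (fun _ _ => abs_nonneg _) fun l _ => ?_
  rw [abs_pow]
  exact pow_le_pow_left₀ (abs_nonneg _) (by simpa using PiLp.norm_apply_le z l) _

/-! ### Remainders of radial Taylor expansions -/

/-- Germs at `0` of finite sums of functions `z ↦ q z * (‖z‖ ^ p * g ‖z‖)`, with `q` a homogeneous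
polynomial of degree `a`, `g` analytic at `0`, and `N ≤ a + p`. -/
inductive IsRadialRemainder {d : ℕ} : ℕ → (EuclideanSpace ℝ (Fin d) → ℝ) → Prop
  | of {N a : ℕ} {p : ℤ} {q : MvPolynomial (Fin d) ℝ} {g : ℝ → ℝ} (hq : q.IsHomogeneous a)
      (hN : (N : ℤ) ≤ a + p) (hg : AnalyticAt ℝ g 0) :
      IsRadialRemainder N fun z => MvPolynomial.eval (fun l => z l) q * (‖z‖ ^ p * g ‖z‖)
  | add {N : ℕ} {φ ψ : EuclideanSpace ℝ (Fin d) → ℝ} (hφ : IsRadialRemainder N φ)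
      (hψ : IsRadialRemainder N ψ) : IsRadialRemainder N fun z => φ z + ψ z
  | congr {N : ℕ} {φ ψ : EuclideanSpace ℝ (Fin d) → ℝ} (hφ : IsRadialRemainder N φ)
      (h : ψ =ᶠ[𝓝 0] φ) : IsRadialRemainder N ψ

namespace IsRadialRemainder

variable {d : ℕ} {φ : EuclideanSpace ℝ (Fin d) → ℝ}

theorem isBigO {N : ℕ} (h : IsRadialRemainder N φ) (hN : 1 ≤ N) :
    φ =O[𝓝 0] fun z => ‖z‖ ^ N := by
  induction h with
  | @of a p q g hq hle hg =>
    have hgO : (fun z : EuclideanSpace ℝ (Fin d) => g ‖z‖) =O[𝓝 0] fun _ => (1 : ℝ) := by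
      have : Tendsto (fun z : EuclideanSpace ℝ (Fin d) => g ‖z‖) (𝓝 0) (𝓝 (g 0)) :=
        hg.continuousAt.tendsto.comp (by simpa using tendsto_norm_zero)
      exact this.isBigO_one ℝ
    have hmain : (fun z : EuclideanSpace ℝ (Fin d) =>
        MvPolynomial.eval (fun l => z l) q * ‖z‖ ^ p) =O[𝓝 0] fun z => ‖z‖ ^ N := by
      refine IsBigO.of_bound (∑ s ∈ q.support, |q.coeff s|) ?_
      have h1 : ∀ᶠ z : EuclideanSpace ℝ (Fin d) in 𝓝 0, ‖z‖ < 1 := by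
        have := Metric.ball_mem_nhds (0 : EuclideanSpace ℝ (Fin d)) one_pos
        filter_upwards [this] with z hz using by simpa using hz
      filter_upwards [h1] with z hz
      have hC : 0 ≤ ∑ s ∈ q.support, |q.coeff s| := Finset.sum_nonneg fun _ _ => abs_nonneg _
      have hq' := abs_eval_le_of_isHomogeneous hq z
      rcases eq_or_ne z 0 with rfl | hz0
      · rw [norm_zero] at hq' ⊢
        rcases eq_or_ne p 0 with rfl | hp
        · have ha : a ≠ 0 := by omega
          rw [zero_pow ha, mul_zero] at hq'
          rw [abs_nonpos_iff.1 hq', zero_mul, norm_zero]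
          positivity
        -- At the origin `0 ^ p = 0` for negative `p` as well, by convention, so singular powers of
        -- the norm cause no trouble there.
        · rw [zero_zpow _ hp, mul_zero, norm_zero]
          positivity
      · have hpos : 0 < ‖z‖ := norm_pos_iff.2 hz0
        rw [norm_mul, Real.norm_eq_abs, norm_zpow, norm_norm, norm_pow, norm_norm]
        calc |MvPolynomial.eval (fun l => z l) q| * ‖z‖ ^ p
            ≤ (∑ s ∈ q.support, |q.coeff s|) * ‖z‖ ^ a * ‖z‖ ^ p :=
              mul_le_mul_of_nonneg_right hq' (by positivity)
          _ = (∑ s ∈ q.support, |q.coeff s|) * ‖z‖ ^ ((a : ℤ) + p) := by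
              rw [mul_assoc, zpow_add₀ hpos.ne', zpow_natCast]
          _ ≤ (∑ s ∈ q.support, |q.coeff s|) * ‖z‖ ^ N := by
              refine mul_le_mul_of_nonneg_left ?_ hC
              rw [← zpow_natCast]
              exact zpow_le_zpow_right_of_le_one₀ hpos hz.le hle
    simpa [mul_assoc] using hmain.mul hgO
  | add _ _ h1 h2 => exact h1.add h2
  | congr _ h ih => exact ih.congr' h.symm EventuallyEq.rfl

theorem apply_zero {N : ℕ} (h : IsRadialRemainder N φ) (hN : 1 ≤ N) : φ 0 = 0 := by
  have := ((h.isBigO hN).eq_zero_imp).self_of_nhds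
  exact this (by simp; omega)

/-- The product rule keeps the class stable at the cost of one order. Differentiating `q` lowers its
degree by one; differentiating the radial factor multiplies `q` by a coordinate and lowers the
exponent of the norm by two. -/
theorem exists_hasLineDerivAt_of_ne_zero {N : ℕ} (h : IsRadialRemainder (N + 1) φ) (i : Fin d) :
    ∃ φ', IsRadialRemainder N φ' ∧ ∀ᶠ z in 𝓝 0, z ≠ 0 →
      HasLineDerivAt ℝ φ (φ' z) z (EuclideanSpace.single i 1) := by
  induction h with
  | @of a p q g hq hle hg =>
    have h₁ : IsRadialRemainder N fun z : EuclideanSpace ℝ (Fin d) =>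
        MvPolynomial.eval (fun l => z l) (MvPolynomial.pderiv i q) * (‖z‖ ^ p * g ‖z‖) := by
      -- For constant `q` the degree `a - 1` would be truncated. The derivative is then the zero
      -- polynomial, homogeneous of every degree, so a degree large enough to absorb a negative `p`
      -- is used.
      rcases Nat.eq_zero_or_pos a with rfl | ha
      · have hq0 : MvPolynomial.pderiv i q = 0 := by
          rw [← MvPolynomial.totalDegree_zero_iff_isHomogeneous,
            MvPolynomial.totalDegree_eq_zero_iff_eq_C] at hq
          rw [hq, MvPolynomial.pderiv_C]
        rw [hq0]
        refine .of (MvPolynomial.isHomogeneous_zero _ _ (N + p.natAbs)) ?_ hg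
        push_cast
        have := neg_abs_le p
        linarith
      · exact .of hq.pderiv (by omega) hg
    have h₂ : IsRadialRemainder N fun z : EuclideanSpace ℝ (Fin d) =>
        MvPolynomial.eval (fun l => z l) (q * MvPolynomial.X i) *
          (‖z‖ ^ (p - 2) * ((fun t => p * g t + t * deriv g t) ‖z‖)) := by
      refine .of (g := fun t => p * g t + t * deriv g t)
        (hq.mul (MvPolynomial.isHomogeneous_X ℝ i)) ?_ ?_
      · push_cast at hle ⊢; linarith
      exact (analyticAt_const.mul hg).add (analyticAt_id.mul hg.deriv)
    refine ⟨_, h₁.add h₂, ?_⟩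
    have hev : ∀ᶠ z : EuclideanSpace ℝ (Fin d) in 𝓝 0, AnalyticAt ℝ g ‖z‖ := by
      have : Tendsto (fun z : EuclideanSpace ℝ (Fin d) => ‖z‖) (𝓝 0) (𝓝 0) := by
        simpa using tendsto_norm_zero
      exact this.eventually hg.eventually_analyticAt
    filter_upwards [hev] with z hgz hz
    have hpos : ‖z‖ ≠ 0 := norm_ne_zero_iff.2 hz
    have hψ := (hasDerivAt_zpow p ‖z‖ (Or.inl hpos)).mul hgz.differentiableAt.hasDerivAt
    have hl := HasLineDerivAt.comp_hasDerivAt_norm i hz hψ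
    have hp := hasLineDerivAt_eval q i z
    unfold HasLineDerivAt at hl hp ⊢
    refine (hp.mul hl).congr_deriv ?_
    simp only [zero_smul, add_zero, map_mul, MvPolynomial.eval_X, Pi.mul_apply]
    have e1 : ‖z‖ ^ (p - 1) = ‖z‖ ^ (p - 2) * ‖z‖ := by
      rw [← zpow_add_one₀ hpos]; congr 1; ring
    have e2 : ‖z‖ ^ p = ‖z‖ ^ (p - 2) * ‖z‖ ^ 2 := by
      rw [← zpow_natCast, ← zpow_add₀ hpos]; congr 1; push_cast; ring
    rw [e1, e2]
    field_simp
  | add _ _ h1 h2 =>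
    obtain ⟨φ', hφ', h1⟩ := h1
    obtain ⟨ψ', hψ', h2⟩ := h2
    refine ⟨_, hφ'.add hψ', ?_⟩
    filter_upwards [h1, h2] with z h1 h2 hz
    exact HasDerivAt.add (h1 hz) (h2 hz)
  | congr _ h ih =>
    obtain ⟨φ', hφ', h1⟩ := ih
    refine ⟨φ', hφ', ?_⟩
    filter_upwards [h1, h.eventuallyEq_nhds] with z h1 h2 hz
    exact (h1 hz).congr_of_eventuallyEq h2

/-- At the origin the function is of order `‖z‖^(N+1)` with `N + 1 ≥ 2`, so its derivative is `0`,
which is also the value there of the formula valid elsewhere. -/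
theorem exists_hasLineDerivAt {N : ℕ} (hN : 1 ≤ N) (h : IsRadialRemainder (N + 1) φ)
    (i : Fin d) :
    ∃ φ', IsRadialRemainder N φ' ∧ ∀ᶠ z in 𝓝 0,
      HasLineDerivAt ℝ φ (φ' z) z (EuclideanSpace.single i 1) := by
  obtain ⟨φ', hφ', hev⟩ := h.exists_hasLineDerivAt_of_ne_zero i
  refine ⟨φ', hφ', ?_⟩
  filter_upwards [hev] with z hz
  rcases eq_or_ne z 0 with rfl | hz0
  · rw [hφ'.apply_zero hN]
    have hF : HasFDerivAt φ (0 : EuclideanSpace ℝ (Fin d) →L[ℝ] ℝ) 0 := by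
      rw [hasFDerivAt_iff_isLittleO_nhds_zero]
      have h0 := h.apply_zero (by omega)
      simp only [zero_add, h0, sub_zero, zero_apply]
      refine (h.isBigO (by omega)).trans_isLittleO ?_
      exact (isLittleO_pow_id (by omega : 1 < N + 1)).comp_tendsto tendsto_norm_zero |>.norm_right
        |>.congr_right (fun z => by simp) |>.of_norm_right
    simpa using hF.hasLineDerivAt (EuclideanSpace.single i 1)
  · exact hz hz0

end IsRadialRemainder

/-! ### Iterated partial derivatives -/

/-- The iterated partial derivative of a polynomial. -/
def multiPDeriv {d : ℕ} (α : Fin d → ℕ) (P : MvPolynomial (Fin d) ℝ) : MvPolynomial (Fin d) ℝ :=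
  (List.finRange d).foldr (fun i Q => (MvPolynomial.pderiv i)^[α i] Q) P

/-- `φ` agrees near `0` with the polynomial `P` up to a remainder of order `N`. -/
def HasRadialExpansion {d : ℕ} (N : ℕ) (P : MvPolynomial (Fin d) ℝ)
    (φ : EuclideanSpace ℝ (Fin d) → ℝ) : Prop :=
  ∃ ρ, IsRadialRemainder N ρ ∧
    φ =ᶠ[𝓝 0] fun z => MvPolynomial.eval (fun l => z l) P + ρ z

namespace HasRadialExpansion

variable {d N : ℕ} {P : MvPolynomial (Fin d) ℝ} {φ : EuclideanSpace ℝ (Fin d) → ℝ}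

theorem partialDeriv (hN : 1 ≤ N) (h : HasRadialExpansion (N + 1) P φ) (i : Fin d) :
    HasRadialExpansion N (MvPolynomial.pderiv i P) (FlatLimit.partialDeriv i φ) := by
  obtain ⟨ρ, hρ, he⟩ := h
  obtain ⟨ρ', hρ', he'⟩ := hρ.exists_hasLineDerivAt hN i
  refine ⟨ρ', hρ', ?_⟩
  filter_upwards [he', he.eventuallyEq_nhds] with z h1 h2
  have h3 : HasLineDerivAt ℝ
      (fun z => MvPolynomial.eval (fun l => z l) P + ρ z)
      (MvPolynomial.eval (fun l => z l) (MvPolynomial.pderiv i P) + ρ' z) z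
      (EuclideanSpace.single i 1) := HasDerivAt.add (hasLineDerivAt_eval P i z) h1
  exact (h3.congr_of_eventuallyEq h2).lineDeriv

theorem iterate_partialDeriv (hN : 1 ≤ N) (i : Fin d) (j : ℕ)
    (h : HasRadialExpansion (N + j) P φ) :
    HasRadialExpansion N ((MvPolynomial.pderiv i)^[j] P) ((FlatLimit.partialDeriv i)^[j] φ) := by
  induction j generalizing P φ with
  | zero => exact h
  | succ j ih =>
    simp only [Function.iterate_succ, Function.comp]
    exact ih (partialDeriv (hN.trans (Nat.le_add_right _ _)) h i)

theorem multiDeriv (hN : 1 ≤ N) (α : Fin d → ℕ)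
    (h : HasRadialExpansion (N + ∑ i, α i) P φ) :
    HasRadialExpansion N (multiPDeriv α P) (FlatLimit.multiDeriv α φ) := by
  unfold multiPDeriv FlatLimit.multiDeriv
  rw [Fin.sum_univ_def] at h
  generalize List.finRange d = l at h ⊢
  induction l generalizing N with
  | nil => simpa using h
  | cons i l ih =>
    rw [List.map_cons, List.sum_cons, ← add_assoc] at h
    exact iterate_partialDeriv hN i (α i) (ih (hN.trans (Nat.le_add_right _ _)) h)

theorem apply_zero (hN : 1 ≤ N) (h : HasRadialExpansion N P φ) :
    φ 0 = MvPolynomial.constantCoeff P := by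
  obtain ⟨ρ, hρ, he⟩ := h
  refine he.self_of_nhds.trans ?_
  simp only [hρ.apply_zero hN, add_zero]
  exact congrArg (fun F => F P) MvPolynomial.eval_zero'

end HasRadialExpansion

theorem partialDeriv_const_mul {d : ℕ} (i : Fin d) (c : ℝ)
    (φ : EuclideanSpace ℝ (Fin d) → ℝ) :
    partialDeriv i (fun z => c * φ z) = fun z => c * partialDeriv i φ z := by
  funext z
  exact deriv_const_mul_field c

theorem partialDeriv_comp_const_sub {d : ℕ} (i : Fin d) (x : EuclideanSpace ℝ (Fin d))
    (φ : EuclideanSpace ℝ (Fin d) → ℝ) :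
    partialDeriv i (fun y => φ (x - y)) = fun y => -1 * partialDeriv i φ (x - y) := by
  funext y
  have h : lineDeriv ℝ (fun y => φ (x - y)) y (EuclideanSpace.single i 1) =
      lineDeriv ℝ φ (x - y) (-EuclideanSpace.single i 1) := by
    unfold lineDeriv
    congr 1
    funext t
    rw [smul_neg, ← sub_eq_add_neg, sub_sub]
  unfold partialDeriv
  rw [h, lineDeriv_neg, neg_one_mul]

theorem iterate_partialDeriv_const_mul {d : ℕ} (i : Fin d) (j : ℕ) (c : ℝ)
    (φ : EuclideanSpace ℝ (Fin d) → ℝ) :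
    (partialDeriv i)^[j] (fun z => c * φ z) = fun z => c * (partialDeriv i)^[j] φ z := by
  induction j generalizing φ with
  | zero => rfl
  | succ j ih => simp only [Function.iterate_succ, Function.comp, partialDeriv_const_mul, ih]

theorem iterate_partialDeriv_comp_const_sub {d : ℕ} (i : Fin d) (j : ℕ)
    (x : EuclideanSpace ℝ (Fin d)) (φ : EuclideanSpace ℝ (Fin d) → ℝ) :
    (partialDeriv i)^[j] (fun y => φ (x - y)) =
      fun y => (-1) ^ j * (partialDeriv i)^[j] φ (x - y) := by
  induction j generalizing φ with
  | zero => simp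
  | succ j ih =>
    simp only [Function.iterate_succ, Function.comp, partialDeriv_comp_const_sub]
    rw [iterate_partialDeriv_const_mul, ih]
    funext y; ring

theorem multiDeriv_const_mul {d : ℕ} (α : Fin d → ℕ) (c : ℝ)
    (φ : EuclideanSpace ℝ (Fin d) → ℝ) :
    multiDeriv α (fun z => c * φ z) = fun z => c * multiDeriv α φ z := by
  unfold multiDeriv
  induction List.finRange d with
  | nil => rfl
  | cons i l ih => simp only [List.foldr_cons, ih, iterate_partialDeriv_const_mul]

theorem multiDeriv_comp_const_sub {d : ℕ} (α : Fin d → ℕ) (x : EuclideanSpace ℝ (Fin d))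
    (φ : EuclideanSpace ℝ (Fin d) → ℝ) :
    multiDeriv α (fun y => φ (x - y)) =
      fun y => (-1) ^ (∑ i, α i) * multiDeriv α φ (x - y) := by
  unfold multiDeriv
  rw [Fin.sum_univ_def]
  induction List.finRange d with
  | nil => simp
  | cons i l ih =>
    simp only [List.foldr_cons, ih, iterate_partialDeriv_const_mul]
    rw [iterate_partialDeriv_comp_const_sub i (α i) x
      (List.foldr (fun i h => (partialDeriv i)^[α i] h) φ l)]
    funext y
    rw [List.map_cons, List.sum_cons, pow_add]; ring

/-! ### Coefficients of iterated derivatives of polynomials -/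

/-- Multiplying the coefficient by `γ!` removes the combinatorial factor of a derivative, leaving a
pure shift of exponents that iterates without bookkeeping. -/
theorem factorial_mul_coeff_pderiv {d : ℕ} (γ : Fin d →₀ ℕ) (i : Fin d)
    (P : MvPolynomial (Fin d) ℝ) :
    (∏ l, ((γ l).factorial : ℝ)) * (MvPolynomial.pderiv i P).coeff γ =
      (∏ l, (((γ + Finsupp.single i 1 : Fin d →₀ ℕ) l).factorial : ℝ)) *
        P.coeff (γ + Finsupp.single i 1) := by
  rw [MvPolynomial.coeff_pderiv, ← Finset.mul_prod_erase _ _ (Finset.mem_univ i),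
    ← Finset.mul_prod_erase (a := i) (s := Finset.univ)
      (fun l => (((γ + Finsupp.single i 1 : Fin d →₀ ℕ) l).factorial : ℝ)) (Finset.mem_univ i)]
  have : ∏ l ∈ Finset.univ.erase i, (((γ + Finsupp.single i 1 : Fin d →₀ ℕ) l).factorial : ℝ) =
      ∏ l ∈ Finset.univ.erase i, ((γ l).factorial : ℝ) := by
    refine Finset.prod_congr rfl fun l hl => ?_
    have := Finset.ne_of_mem_erase hl
    simp [this.symm]
  rw [this]
  simp only [Finsupp.add_apply, Finsupp.single_eq_same, Nat.factorial_succ]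
  push_cast; ring

theorem factorial_mul_coeff_iterate_pderiv {d : ℕ} (γ : Fin d →₀ ℕ) (i : Fin d) (j : ℕ)
    (P : MvPolynomial (Fin d) ℝ) :
    (∏ l, ((γ l).factorial : ℝ)) * ((MvPolynomial.pderiv i)^[j] P).coeff γ =
      (∏ l, (((γ + Finsupp.single i j : Fin d →₀ ℕ) l).factorial : ℝ)) *
        P.coeff (γ + Finsupp.single i j) := by
  induction j generalizing P with
  | zero => simp
  | succ j ih =>
    rw [Function.iterate_succ, Function.comp, ih, factorial_mul_coeff_pderiv, add_assoc,
      ← Finsupp.single_add]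

theorem factorial_mul_coeff_multiPDeriv {d : ℕ} (γ : Fin d →₀ ℕ) (α : Fin d → ℕ)
    (P : MvPolynomial (Fin d) ℝ) :
    (∏ l, ((γ l).factorial : ℝ)) * (multiPDeriv α P).coeff γ =
      (∏ l, (((γ + Finsupp.equivFunOnFinite.symm α : Fin d →₀ ℕ) l).factorial : ℝ)) *
        P.coeff (γ + Finsupp.equivFunOnFinite.symm α) := by
  have h : Finsupp.equivFunOnFinite.symm α =
      ((List.finRange d).map fun i => Finsupp.single i (α i)).sum := by
    rw [← Fin.sum_univ_def]
    exact (Finsupp.univ_sum_single (Finsupp.equivFunOnFinite.symm α)).symm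
  rw [h]
  unfold multiPDeriv
  induction List.finRange d generalizing γ with
  | nil => simp
  | cons i l ih =>
    rw [List.foldr_cons, factorial_mul_coeff_iterate_pderiv, ih, List.map_cons, List.sum_cons,
      add_assoc]

end FlatLimit

/-! ### The even Taylor polynomial and its coefficients in the two variables -/

namespace FlatLimit

/-! ### Taylor expansion of the profile -/

/-- The remainder is the iterated divided difference `dslope` at `0`. It is analytic at `0`, and the
identity holds at every `s`, not just near `0`. -/
theorem exists_taylor_remainder {f : ℝ → ℝ} (hf : AnalyticAt ℝ f 0) (n : ℕ) :
    ∃ g : ℝ → ℝ, AnalyticAt ℝ g 0 ∧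
      ∀ s, f s = ∑ i ∈ Finset.range n, taylorCoeff f i * s ^ i + s ^ n * g s := by
  have hp := hf.hasFPowerSeriesAt
  have hn : ∀ n, HasFPowerSeriesAt ((Function.swap dslope 0)^[n] f) _ 0 :=
    fun n => hp.has_fpower_series_iterate_dslope_fslope n
  refine ⟨_, ⟨_, hn n⟩, fun s => ?_⟩
  induction n with
  | zero => simp
  | succ n ih =>
    have h0 : (Function.swap dslope 0)^[n] f 0 = taylorCoeff f n := by
      rw [← (hn n).coeff_zero 1]
      change FormalMultilinearSeries.coeff _ 0 = _
      rw [FormalMultilinearSeries.coeff_iterate_fslope, zero_add,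
        FormalMultilinearSeries.coeff_ofScalars]
      rfl
    have h1 := sub_smul_dslope ((Function.swap dslope 0)^[n] f) 0 s
    rw [h0, sub_zero, smul_eq_mul] at h1
    rw [ih, Finset.sum_range_succ, Function.iterate_succ_apply', Function.swap]
    linear_combination (-s ^ n) * h1

theorem taylorCoeff_odd_eq_zero {f : ℝ → ℝ} {k : ℕ} (hk : (k : ℕ∞) + 1 ≤ smoothnessOrder f)
    {j : ℕ} (hj : j < k) : taylorCoeff f (2 * j + 1) = 0 := by
  by_contra h
  have h1 : smoothnessOrder f ≤ ((j + 1 : ℕ) : ℕ∞) := sInf_le ⟨j + 1, by omega, h, rfl⟩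
  have h2 := hk.trans h1
  norm_cast at h2
  omega

/-- The polynomial `∑_{j ≤ k} f_{2j} ‖z‖^{2j}`. -/
def evenTaylorPoly (d : ℕ) (f : ℝ → ℝ) (k : ℕ) : MvPolynomial (Fin d) ℝ :=
  ∑ j ∈ Finset.range (k + 1),
    MvPolynomial.C (taylorCoeff f (2 * j)) * (∑ l, MvPolynomial.X l ^ 2) ^ j

theorem eval_evenTaylorPoly {d : ℕ} (f : ℝ → ℝ) (k : ℕ) (z : EuclideanSpace ℝ (Fin d)) :
    MvPolynomial.eval (fun l => z l) (evenTaylorPoly d f k) =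
      ∑ j ∈ Finset.range (k + 1), taylorCoeff f (2 * j) * ‖z‖ ^ (2 * j) := by
  simp [evenTaylorPoly, pow_mul, EuclideanSpace.norm_sq_eq]

theorem totalDegree_evenTaylorPoly_le (d : ℕ) (f : ℝ → ℝ) (k : ℕ) :
    (evenTaylorPoly d f k).totalDegree ≤ 2 * k := by
  refine MvPolynomial.totalDegree_finsetSum_le fun j hj => ?_
  have hs : (∑ l : Fin d, (MvPolynomial.X l : MvPolynomial (Fin d) ℝ) ^ 2).IsHomogeneous 2 :=
    MvPolynomial.IsHomogeneous.sum _ _ _ fun l _ => MvPolynomial.isHomogeneous_X_pow l 2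
  have := ((hs.pow j).C_mul (taylorCoeff f (2 * j))).totalDegree_le
  have := Finset.mem_range.1 hj
  omega

theorem exists_even_taylor_remainder {f : ℝ → ℝ} (hf : AnalyticAt ℝ f 0) {k : ℕ}
    (hk : (k : ℕ∞) + 1 ≤ smoothnessOrder f) (d : ℕ) :
    ∃ g : ℝ → ℝ, AnalyticAt ℝ g 0 ∧ ∀ z : EuclideanSpace ℝ (Fin d),
      f ‖z‖ = MvPolynomial.eval (fun l => z l) (evenTaylorPoly d f k) +
        ‖z‖ ^ (2 * k + 1) * g ‖z‖ := by
  obtain ⟨g, hg, hfg⟩ := exists_taylor_remainder hf (2 * k + 1)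
  refine ⟨g, hg, fun z => ?_⟩
  rw [hfg, eval_evenTaylorPoly]
  congr 1
  -- Each induction step adds the orders `2i + 1` and `2i + 2`, the former having zero coefficient.
  have : ∀ i ≤ k, ∑ j ∈ Finset.range (2 * i + 1), taylorCoeff f j * ‖z‖ ^ j =
      ∑ j ∈ Finset.range (i + 1), taylorCoeff f (2 * j) * ‖z‖ ^ (2 * j) := by
    intro i hi
    induction i with
    | zero => simp
    | succ i ih =>
      rw [Finset.sum_range_succ _ (i + 1), ← ih (by omega), mul_add_one, Finset.sum_range_succ,
        Finset.sum_range_succ, taylorCoeff_odd_eq_zero hk (by omega)]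
      ring
  exact this k le_rfl

/-! ### Two-variable expansion of a polynomial in the difference -/

/-- The coefficient of `x^α y^β` in `P (x - y)`. -/
def diffCoeff {d : ℕ} (P : MvPolynomial (Fin d) ℝ) (α β : Fin d → ℕ) : ℝ :=
  (-1) ^ (∑ l, β l) * (∏ l, ((α l + β l).choose (α l) : ℝ)) *
    P.coeff (Finsupp.equivFunOnFinite.symm (α + β))

theorem prod_sub_pow_eq_sum {d K : ℕ} (u v : Fin d → ℝ) {γ : Fin d → ℕ}
    (hγ : γ ∈ multiIndices d K) :
    ∏ l, (u l - v l) ^ γ l = ∑ α ∈ multiIndices d K, ∑ β ∈ multiIndices d K,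
      if α + β = γ then (-1) ^ (∑ l, β l) * (∏ l, ((α l + β l).choose (α l) : ℝ)) *
        ((∏ l, u l ^ α l) * ∏ l, v l ^ β l) else 0 := by
  have h1 : ∏ l, (u l - v l) ^ γ l =
      ∏ l, ∑ p ∈ Finset.HasAntidiagonal.antidiagonal (γ l),
        ((-1) ^ p.2 * ((p.1 + p.2).choose p.1 : ℝ) * (u l ^ p.1 * v l ^ p.2)) := by
    refine Finset.prod_congr rfl fun l _ => ?_
    rw [sub_eq_add_neg, (Commute.all (u l) (-v l)).add_pow']
    refine Finset.sum_congr rfl fun p hp => ?_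
    rw [Finset.HasAntidiagonal.mem_antidiagonal.1 hp, neg_pow, nsmul_eq_mul]
    ring
  rw [h1, Finset.prod_univ_sum, ← Finset.sum_product', ← Finset.sum_filter]
  refine Finset.sum_bij' (fun p _ => (fun l => (p l).1, fun l => (p l).2))
    (fun q _ l => (q.1 l, q.2 l)) ?_ ?_ ?_ ?_ ?_
  · intro p hp
    rw [Fintype.mem_piFinset] at hp
    simp only [Finset.HasAntidiagonal.mem_antidiagonal] at hp
    rw [mem_multiIndices] at hγ
    simp only [Finset.mem_filter, Finset.mem_product, mem_multiIndices]
    refine ⟨⟨?_, ?_⟩, funext hp⟩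
    · exact (Finset.sum_le_sum fun l _ => by have := hp l; omega).trans hγ
    · exact (Finset.sum_le_sum fun l _ => by have := hp l; omega).trans hγ
  · intro q hq
    simp only [Finset.mem_filter] at hq
    rw [Fintype.mem_piFinset]
    intro l
    simpa using congrFun hq.2 l
  · intro p _; rfl
  · intro q _; rfl
  · intro p _
    simp only [Finset.prod_mul_distrib, Finset.prod_pow_eq_pow_sum]

theorem eval_sub_eq_sum_diffCoeff {d K : ℕ} {P : MvPolynomial (Fin d) ℝ}
    (hP : P.totalDegree ≤ K) (u v : Fin d → ℝ) :
    MvPolynomial.eval (fun l => u l - v l) P =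
      ∑ α ∈ multiIndices d K, ∑ β ∈ multiIndices d K,
        diffCoeff P α β * ((∏ l, u l ^ α l) * ∏ l, v l ^ β l) := by
  have hcoeff : ∀ γ ∉ multiIndices d K, P.coeff (Finsupp.equivFunOnFinite.symm γ) = 0 := by
    intro γ hγ
    rw [mem_multiIndices, not_le] at hγ
    refine MvPolynomial.coeff_eq_zero_of_totalDegree_lt (hP.trans_lt ?_)
    have : ∑ l, γ l = (Finsupp.equivFunOnFinite.symm γ).degree := by
      rw [Finsupp.degree_eq_sum]; rfl
    rw [this] at hγ
    exact hγ
  have h1 : MvPolynomial.eval (fun l => u l - v l) P =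
      ∑ γ ∈ multiIndices d K, P.coeff (Finsupp.equivFunOnFinite.symm γ) *
        ∏ l, (u l - v l) ^ γ l := by
    rw [MvPolynomial.eval_eq']
    refine Eq.trans ?_
      (Finset.sum_map (multiIndices d K) Finsupp.equivFunOnFinite.symm.toEmbedding
        (fun s => P.coeff s * ∏ l, (u l - v l) ^ s l))
    refine Finset.sum_subset (fun s hs => ?_) fun s _ hs => ?_
    · rw [Finset.mem_map]
      refine ⟨s, ?_, by ext; rfl⟩
      by_contra h
      have := hcoeff _ h
      rw [Finsupp.equivFunOnFinite_symm_coe] at this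
      exact MvPolynomial.mem_support_iff.1 hs this
    · rw [MvPolynomial.notMem_support_iff.1 hs, zero_mul]
  rw [h1, Finset.sum_congr rfl fun γ hγ => by rw [prod_sub_pow_eq_sum u v hγ]]
  simp only [Finset.mul_sum]
  rw [Finset.sum_comm]
  refine Finset.sum_congr rfl fun α _ => ?_
  rw [Finset.sum_comm]
  refine Finset.sum_congr rfl fun β _ => ?_
  simp only [mul_ite, mul_zero]
  rw [Finset.sum_ite_eq]
  unfold diffCoeff
  split_ifs with h
  · ring
  · rw [hcoeff _ h]; ring

/-! ### The Wronskian matrix of a stationary kernel -/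

theorem coeff_multiPDeriv_multiPDeriv {d : ℕ} (α β : Fin d → ℕ) (P : MvPolynomial (Fin d) ℝ) :
    MvPolynomial.constantCoeff (multiPDeriv α (multiPDeriv β P)) =
      (∏ l, ((α l + β l).factorial : ℝ)) *
        P.coeff (Finsupp.equivFunOnFinite.symm (α + β)) := by
  have h1 := factorial_mul_coeff_multiPDeriv 0 α (multiPDeriv β P)
  rw [zero_add] at h1
  have h2 := factorial_mul_coeff_multiPDeriv (Finsupp.equivFunOnFinite.symm α) β P
  rw [h2] at h1
  simp only [Finsupp.coe_zero, Pi.zero_apply, Nat.factorial_zero, Nat.cast_one,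
    Finset.prod_const_one, one_mul] at h1
  rw [MvPolynomial.constantCoeff_eq, h1]
  have : Finsupp.equivFunOnFinite.symm α + Finsupp.equivFunOnFinite.symm β =
      Finsupp.equivFunOnFinite.symm (α + β) := by ext; simp
  rw [this]
  rfl

/-- Derivatives of total order at most `2k` do not see a remainder of order `2k + 1`, so at the
origin they are those of the polynomial. The sign comes from differentiating `x - y` in `y`, the
binomials from `(α+β)! / (α! β!)`. -/
theorem wronskian_eq_diffCoeff {d : ℕ}
    {κ : EuclideanSpace ℝ (Fin d) → EuclideanSpace ℝ (Fin d) → ℝ} {f : ℝ → ℝ}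
    (hκ : IsStationaryKernel κ f) {k : ℕ} (hk : (k : ℕ∞) + 1 ≤ smoothnessOrder f)
    (α β : multiIndices d k) :
    wronskian k κ α β = diffCoeff (evenTaylorPoly d f k) α β := by
  obtain ⟨g, hg, hfg⟩ := exists_even_taylor_remainder hκ.analytic hk d
  set P := evenTaylorPoly d f k with hP
  have hα := mem_multiIndices.1 α.2
  have hβ := mem_multiIndices.1 β.2
  have hexp : HasRadialExpansion (2 * k + 1) P fun z : EuclideanSpace ℝ (Fin d) => f ‖z‖ := by
    refine ⟨_, .of (p := 2 * k + 1) (MvPolynomial.isHomogeneous_one (Fin d) ℝ)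
      (by push_cast; omega) hg, Eventually.of_forall fun z => ?_⟩
    simp only [hfg z, map_one, one_mul]
    norm_cast
  -- The leading `1` guarantees that the remainder left after both differentiations still vanishes
  -- at the origin.
  obtain ⟨e, he⟩ : ∃ e, 2 * k + 1 = 1 + e + ∑ i, α.1 i + ∑ i, β.1 i :=
    ⟨2 * k - ∑ i, α.1 i - ∑ i, β.1 i, by omega⟩
  rw [he] at hexp
  have hval := ((hexp.multiDeriv (by omega) β.1).multiDeriv (by omega) α.1).apply_zero
    (by omega)
  rw [coeff_multiPDeriv_multiPDeriv] at hval
  have hker : (fun x => multiDeriv β.1 (fun y => κ x y) 0) =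
      fun x => (-1) ^ (∑ i, β.1 i) *
        multiDeriv β.1 (fun z : EuclideanSpace ℝ (Fin d) => f ‖z‖) x := by
    funext x
    have : (fun y => κ x y) = fun y => (fun z => f ‖z‖) (x - y) := by
      funext y; exact hκ.radial x y
    rw [this, multiDeriv_comp_const_sub β.1 x fun z => f ‖z‖]
    simp only [sub_zero]
  have hfac : (∏ l, ((α.1 l + β.1 l).factorial : ℝ)) =
      (∏ l, ((α.1 l + β.1 l).choose (α.1 l) : ℝ)) *
        ((∏ i, ((α.1 i).factorial : ℝ)) * ∏ i, ((β.1 i).factorial : ℝ)) := by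
    rw [← Finset.prod_mul_distrib, ← Finset.prod_mul_distrib]
    refine Finset.prod_congr rfl fun l _ => ?_
    rw [← mul_assoc, Nat.choose_symm_add]
    exact_mod_cast (Nat.add_choose_mul_factorial_mul_factorial (α.1 l) (β.1 l)).symm
  have hne : ((∏ i, ((α.1 i).factorial : ℝ)) * ∏ i, ((β.1 i).factorial : ℝ)) ≠ 0 := by
    positivity
  unfold wronskian diffCoeff
  rw [Matrix.of_apply, hker, multiDeriv_const_mul]
  simp only [hval]
  rw [hfac, div_eq_iff hne]
  ring

theorem card_multiIndices (d k : ℕ) : (multiIndices d k).card = polyDim k d := by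
  have h : (multiIndices d k).card =
      ((Finset.univ : Finset (Fin (d + 1))).finsuppAntidiag k).card := by
    -- Stars and bars: a slack coordinate `k - |α|` turns the inequality into a sum equal to `k`
    -- over `d + 1` coordinates.
    refine Finset.card_bij'
      (fun α _ => Finsupp.equivFunOnFinite.symm (Fin.cons (k - ∑ l, α l) α))
      (fun s _ => Fin.tail s) ?_ ?_ ?_ ?_
    · intro α hα
      rw [mem_multiIndices] at hα
      simp [Finset.mem_finsuppAntidiag, Fin.sum_univ_succ, hα]
    · intro s hs
      simp only [Finset.mem_finsuppAntidiag, Fin.sum_univ_succ] at hs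
      rw [mem_multiIndices]
      simp only [Fin.tail]
      omega
    · intro α _
      rfl
    · intro s hs
      simp only [Finset.mem_finsuppAntidiag, Fin.sum_univ_succ] at hs
      ext l
      refine Fin.cases ?_ (fun l => ?_) l
      · simp only [Finsupp.equivFunOnFinite_symm_apply_apply, Fin.cons_zero, Fin.tail]
        omega
      · rfl
  rw [h, Finset.card_finsuppAntidiag_nat_eq_choose, Finset.card_univ, Fintype.card_fin, polyDim]
  have : d + 1 + k - 1 = k + d := by omega
  rw [this, Nat.choose_symm_add]

end FlatLimit

/-! ### From the expansion of the kernel to the limit of its minors -/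

namespace FlatLimit

open Matrix

/-! ### Asymptotics of the principal minors of the kernel matrix -/

theorem sum_multiIndices_ite {d k K : ℕ} (hkK : k ≤ K) (p : multiIndices d K → Prop)
    [DecidablePred p] (hp : ∀ α, p α ↔ ∑ l, α.1 l ≤ k) (F : (Fin d → ℕ) → ℝ) :
    (∑ α, if p α then F α.1 else 0) = ∑ α : multiIndices d k, F α.1 := by
  simp only [hp]
  rw [Finset.sum_coe_sort (multiIndices d K) (fun α => if ∑ l, α l ≤ k then F α else 0),
    Finset.sum_coe_sort (multiIndices d k) F, ← Finset.sum_filter]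
  refine Finset.sum_congr (Finset.ext fun α => ?_) fun _ _ => rfl
  rw [Finset.mem_filter, mem_multiIndices, mem_multiIndices]
  omega

/-- The graded weights used in the expansion of the kernel matrix. -/
def gradedWeight (d k : ℕ) (ι : Type*) : multiIndices d (2 * k) ⊕ ι → ℕ :=
  Sum.elim (fun α => 2 * ∑ l, α.1 l) fun _ => 2 * k + 1

theorem gradedWeight_inl_le {d k : ℕ} (ι : Type*) (α : multiIndices d (2 * k)) :
    gradedWeight d k ι (Sum.inl α) ≤ 2 * k ↔ ∑ l, α.1 l ≤ k := by
  simp [gradedWeight]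

theorem not_gradedWeight_inr_le {d k : ℕ} {ι : Type*} (i : ι) :
    ¬ gradedWeight d k ι (Sum.inr i) ≤ 2 * k := by
  simp [gradedWeight]

theorem sum_gradedWeight_le {d k : ℕ} (ι : Type*) [Fintype ι] (F : (Fin d → ℕ) → ℝ) (G : ι → ℝ) :
    (∑ a with gradedWeight d k ι a ≤ 2 * k, Sum.elim (fun α => F α.1) G a) =
      ∑ α : multiIndices d k, F α.1 := by
  rw [Finset.sum_filter, Fintype.sum_sum_type,
    Finset.sum_eq_zero (s := (Finset.univ : Finset ι))
      fun i _ => if_neg (not_gradedWeight_inr_le i), add_zero]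
  exact sum_multiIndices_ite (by omega) _ (gradedWeight_inl_le ι) F

theorem card_filter_gradedWeight_le {d k : ℕ} (ι : Type*) [Fintype ι] :
    (Finset.univ.filter fun a => gradedWeight d k ι a ≤ 2 * k).card = polyDim k d := by
  have h := sum_gradedWeight_le (d := d) (k := k) ι (fun _ => 1) fun _ => 1
  have h' : ∀ a, Sum.elim (fun _ : multiIndices d (2 * k) => (1 : ℝ)) (fun _ : ι => 1) a = 1 := by
    rintro (a | a) <;> rfl
  simp only [h'] at h
  simpa [card_multiIndices] using h

theorem sum_filter_gradedWeight_le {d k : ℕ} (ι : Type*) [Fintype ι] :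
    (∑ a with gradedWeight d k ι a ≤ 2 * k, gradedWeight d k ι a) =
      ∑ α : multiIndices d k, 2 * ∑ l, α.1 l := by
  have h := sum_gradedWeight_le (d := d) (k := k) ι (fun α => ((2 * ∑ l, α l : ℕ) : ℝ))
    fun _ => ((2 * k + 1 : ℕ) : ℝ)
  have h' : Sum.elim (fun α : multiIndices d (2 * k) => ((2 * ∑ l, α.1 l : ℕ) : ℝ))
      (fun _ : ι => ((2 * k + 1 : ℕ) : ℝ)) = fun a => (gradedWeight d k ι a : ℝ) := by
    funext a
    rcases a with a | a <;> rfl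
  simp only [h'] at h
  exact_mod_cast h

/-- Appending identity columns to `V` absorbs the additive remainder into a single graded
congruence, the form needed for `tendsto_det_graded_div`. -/
theorem fromCols_one_mul_graded_apply {ι A : Type*} [Fintype ι] [DecidableEq ι] [Fintype A]
    [DecidableEq A] (V : Matrix ι A ℝ) (v : A → ℝ) (c : ℝ) (W : Matrix A A ℝ)
    (E : Matrix ι ι ℝ) (i j : ι) :
    (fromCols V (1 : Matrix ι ι ℝ) * (diagonal (Sum.elim v fun _ : ι => c) * fromBlocks W 0 0 E *
      diagonal (Sum.elim v fun _ : ι => c)) * (fromCols V (1 : Matrix ι ι ℝ))ᵀ) i j =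
      (∑ a, ∑ b, W a b * (v a * V i a * (v b * V j b))) + c ^ 2 * E i j := by
  have h : diagonal (Sum.elim v fun _ : ι => c) * fromBlocks W 0 0 E *
      diagonal (Sum.elim v fun _ : ι => c) =
      fromBlocks (diagonal v * W * diagonal v) 0 0 (c ^ 2 • E) := by
    ext a b
    rcases a with a | a <;> rcases b with b | b <;> simp <;> ring
  rw [h, fromCols_mul_fromBlocks, transpose_fromCols, fromCols_mul_fromRows]
  simp only [Matrix.mul_zero, Matrix.one_mul, add_zero, zero_add,
    transpose_one, Matrix.mul_one, Matrix.add_apply,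
    Matrix.smul_apply, smul_eq_mul]
  congr 1
  rw [mul_apply, Finset.sum_comm]
  refine Finset.sum_congr rfl fun b _ => ?_
  rw [mul_apply, Finset.sum_mul]
  refine Finset.sum_congr rfl fun a _ => ?_
  rw [mul_diagonal, diagonal_mul, transpose_apply]
  ring

/-- The substitution `ε = t ^ 2` lets the remainder factor `ε^(2k+1)` be split evenly as `t^(2k+1) ·
t^(2k+1)`. Its weight `2k + 1` lies just above the threshold `2k`, so the limit does not depend on
`g`. -/
theorem tendsto_principalMinor_kernelMatrix_div {d n : ℕ}
    {κ : EuclideanSpace ℝ (Fin d) → EuclideanSpace ℝ (Fin d) → ℝ} {f : ℝ → ℝ}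
    (hκ : IsStationaryKernel κ f) {k : ℕ} (hk : (k : ℕ∞) + 1 ≤ smoothnessOrder f)
    (x : Fin n → EuclideanSpace ℝ (Fin d)) {X : Finset (Fin n)} (hX : X.card = polyDim k d) :
    Tendsto (fun t : ℝ => principalMinor (kernelMatrix κ x (t ^ 2)) X /
        t ^ (2 * ∑ α : multiIndices d k, 2 * ∑ l, α.1 l)) (𝓝[>] 0)
      (𝓝 ((wronskian k κ).det *
        principalMinor (vandermonde k x * (vandermonde k x)ᵀ) X)) := by
  obtain ⟨g, hg, hfg⟩ := exists_even_taylor_remainder hκ.analytic hk d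
  set P := evenTaylorPoly d f k with hP
  let V : Matrix X (multiIndices d (2 * k)) ℝ := Matrix.of fun i α => ∏ l, x i l ^ α.1 l
  -- All degrees up to `2k` are needed here, because `P (x - y)` contains monomials `x^α y^β` with
  -- one of `|α|`, `|β|` above `k`; only the block with both at most `k` survives in the limit.
  let W : Matrix (multiIndices d (2 * k)) (multiIndices d (2 * k)) ℝ :=
    Matrix.of fun α β => diffCoeff P α β
  let E : ℝ → Matrix X X ℝ := fun t =>
    Matrix.of fun i j => ‖x i - x j‖ ^ (2 * k + 1) * g (t ^ 2 * ‖x i - x j‖)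
  have hE : Tendsto E (𝓝[>] 0) (𝓝 (Matrix.of fun i j => ‖x i - x j‖ ^ (2 * k + 1) * g 0)) := by
    refine tendsto_pi_nhds.2 fun i => tendsto_pi_nhds.2 fun j => ?_
    have h1 : Tendsto (fun t : ℝ => t ^ 2 * ‖x i - x j‖) (𝓝[>] 0) (𝓝 0) := by
      have : Continuous fun t : ℝ => t ^ 2 * ‖x i - x j‖ := by fun_prop
      simpa using (this.tendsto 0).mono_left nhdsWithin_le_nhds
    exact (hg.continuousAt.tendsto.comp h1).const_mul _
  have hM : Tendsto (fun t => fromBlocks W 0 0 (E t)) (𝓝[>] 0)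
      (𝓝 (fromBlocks W 0 0 (Matrix.of fun i j : X => ‖x i - x j‖ ^ (2 * k + 1) * g 0))) := by
    have : Continuous fun B : Matrix X X ℝ => fromBlocks W 0 0 B := by fun_prop
    exact (this.tendsto _).comp hE
  have key := tendsto_det_graded_div (gradedWeight d k X) (2 * k)
    (by rw [card_filter_gradedWeight_le, Fintype.card_coe, hX]) (fromCols V (1 : Matrix X X ℝ)) _ _ hM
  rw [sum_filter_gradedWeight_le] at key
  have hlim : (fromCols V (1 : Matrix X X ℝ) * (Matrix.of fun a b =>
      if gradedWeight d k X a ≤ 2 * k ∧ gradedWeight d k X b ≤ 2 * k then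
        fromBlocks W 0 0 (Matrix.of fun i j : X => ‖x i - x j‖ ^ (2 * k + 1) * g 0) a b
      else 0) * (fromCols V (1 : Matrix X X ℝ))ᵀ) =
      (vandermonde k x * wronskian k κ * (vandermonde k x)ᵀ).submatrix
        (fun i : X => (i : Fin n)) (fun i : X => (i : Fin n)) := by
    -- Inserting trivial diagonal factors puts the limit matrix in the same shape as the scaled one,
    -- so that `fromCols_one_mul_graded_apply` serves for both.
    have hR : (Matrix.of fun a b =>
        if gradedWeight d k X a ≤ 2 * k ∧ gradedWeight d k X b ≤ 2 * k then
          fromBlocks W 0 0 (Matrix.of fun i j : X => ‖x i - x j‖ ^ (2 * k + 1) * g 0) a b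
        else 0) = diagonal (Sum.elim (fun _ => 1) fun _ : X => 1) *
          fromBlocks (Matrix.of fun α β : multiIndices d (2 * k) =>
            if ∑ l, α.1 l ≤ k then if ∑ l, β.1 l ≤ k then W α β else 0 else 0)
            0 0 (0 : Matrix X X ℝ) * diagonal (Sum.elim (fun _ => 1) fun _ : X => 1) := by
      ext a b
      rcases a with a | a <;> rcases b with b | b <;>
        simp [gradedWeight_inl_le, not_gradedWeight_inr_le, ite_and]
    rw [hR]
    ext i j
    rw [fromCols_one_mul_graded_apply, Matrix.zero_apply, mul_zero, add_zero, submatrix_apply,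
      mul_apply]
    simp only [mul_apply, Finset.sum_mul]
    rw [Finset.sum_comm (γ := multiIndices d k)]
    refine Eq.trans ?_ (sum_multiIndices_ite (k := k) (K := 2 * k) (by omega) _ (fun _ => Iff.rfl)
      fun α => ∑ β : multiIndices d k,
        diffCoeff P α β.1 * ((∏ l, x i l ^ α l) * ∏ l, x j l ^ β.1 l)) |>.trans ?_
    · refine Finset.sum_congr rfl fun α _ => ?_
      split_ifs with hα
      · refine Eq.trans ?_ (sum_multiIndices_ite (k := k) (K := 2 * k) (by omega) _ (fun _ => Iff.rfl)
          fun β => diffCoeff P α β * ((∏ l, x i l ^ α.1 l) * ∏ l, x j l ^ β l))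
        refine Finset.sum_congr rfl fun β _ => ?_
        simp [hα, W, V]
      · simp [hα]
    · refine Finset.sum_congr rfl fun α _ => Finset.sum_congr rfl fun β _ => ?_
      rw [wronskian_eq_diffCoeff hκ hk]
      simp only [vandermonde, of_apply, transpose_apply]
      ring
  rw [hlim] at key
  have hlim' : principalMinor (vandermonde k x * wronskian k κ * (vandermonde k x)ᵀ) X =
      (wronskian k κ).det * principalMinor (vandermonde k x * (vandermonde k x)ᵀ) X :=
    principalMinor_mul_mul_transpose _ _ (by rw [Fintype.card_coe, card_multiIndices, hX])
  rw [← hlim']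
  refine key.congr fun t => ?_
  congr 2
  have hdiag : (fun a => t ^ gradedWeight d k X a) =
      Sum.elim (fun α => t ^ (2 * ∑ l, α.1 l)) fun _ => t ^ (2 * k + 1) := by
    funext a
    rcases a with a | a <;> rfl
  rw [hdiag]
  ext i j
  rw [fromCols_one_mul_graded_apply]
  have hker : kernelMatrix κ x (t ^ 2) i j =
      MvPolynomial.eval (fun l => t ^ 2 * x i l - t ^ 2 * x j l) P +
        (t ^ 2 * ‖x i - x j‖) ^ (2 * k + 1) * g (t ^ 2 * ‖x i - x j‖) := by
    have hn : ‖t ^ 2 • (x i - x j)‖ = t ^ 2 * ‖x i - x j‖ := by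
      rw [norm_smul, Real.norm_of_nonneg (sq_nonneg t)]
    have := hfg (t ^ 2 • (x i - x j))
    rw [hn] at this
    simp only [kernelMatrix, of_apply]
    rw [hκ.radial, ← smul_sub, hn, this]
    simp [mul_sub]
  rw [submatrix_apply, hker, eval_sub_eq_sum_diffCoeff (totalDegree_evenTaylorPoly_le d f k)]
  congr 1
  · refine Eq.trans (Finset.sum_congr rfl fun α _ => ?_) (Finset.sum_coe_sort _ _)
    refine Eq.trans (Finset.sum_congr rfl fun β _ => ?_) (Finset.sum_coe_sort _ _)
    simp only [W, V, hP, of_apply, mul_pow, Finset.prod_mul_distrib, Finset.prod_pow_eq_pow_sum,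
      ← pow_mul, Finset.mul_sum]
  · simp only [E, of_apply]
    ring

/-! ### Orthonormal polynomials -/

/-- Each column of `Q` is a combination of monomial columns, hence the vector of values of a
polynomial of degree at most `k`; orthonormality of columns is orthonormality for the counting
measure. -/
theorem isDiscreteOrthogonalPolynomialEnsemble_of_isOrthonormalBasisOfSpan {d n k : ℕ}
    {x : Fin n → EuclideanSpace ℝ (Fin d)} {Q : Matrix (Fin n) (Fin (polyDim k d)) ℝ}
    (hQ : IsOrthonormalBasisOfSpan Q (vandermonde k x)) :
    IsDiscreteOrthogonalPolynomialEnsemble k x (fixedSizeDPP (polyDim k d) (Q * Qᵀ)) := by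
  obtain ⟨C, hC⟩ := exists_eq_mul_of_span_le hQ.2.le
  let p : Fin (polyDim k d) → MvPolynomial (Fin d) ℝ := fun a =>
    ∑ α : multiIndices d k, MvPolynomial.monomial (Finsupp.equivFunOnFinite.symm α.1) (C α a)
  have hp : ∀ i a, MvPolynomial.eval (fun l => x i l) (p a) = Q i a := by
    intro i a
    rw [hC, mul_apply]
    simp only [p, map_sum, MvPolynomial.eval_monomial, vandermonde, of_apply]
    refine Finset.sum_congr rfl fun α _ => ?_
    rw [mul_comm, Finsupp.prod_fintype _ _ fun _ => pow_zero _]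
    rfl
  refine ⟨p, fun a => ?_, fun a b => ?_, fun X => ?_⟩
  · refine MvPolynomial.totalDegree_finsetSum_le fun α _ => ?_
    refine (MvPolynomial.totalDegree_monomial_le _ _).trans ?_
    rw [Finsupp.sum_fintype _ _ fun _ => rfl]
    exact mem_multiIndices.1 α.2
  · simp only [hp]
    have := congrFun (congrFun hQ.1 a) b
    rwa [mul_apply, one_apply] at this
  · rw [fixedSizeDPP_mul_transpose_of_orthonormal hQ.1]
    have : (Matrix.of fun i j => ∑ a, MvPolynomial.eval (fun l => x i l) (p a) *
        MvPolynomial.eval (fun l => x j l) (p a)) = Q * Qᵀ := by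
      ext i j
      simp [hp, mul_apply]
    rw [this]

/-! ### Convergence of the fixed-size L-ensembles -/

theorem isPosSemidef_kernelMatrix {d n : ℕ}
    {κ : EuclideanSpace ℝ (Fin d) → EuclideanSpace ℝ (Fin d) → ℝ}
    (hκ : IsPositiveDefiniteKernel κ) (x : Fin n → EuclideanSpace ℝ (Fin d)) (ε : ℝ) :
    (kernelMatrix κ x ε).PosSemidef :=
  hκ n fun i => ε • x i

theorem fixedSizeDPP_eq_div {n m : ℕ} (L : Matrix (Fin n) (Fin n) ℝ) {c : ℝ} (hc : c ≠ 0)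
    {X : Finset (Fin n)} (hX : X.card = m) :
    fixedSizeDPP m L X = (principalMinor L X / c) /
      ∑ Y ∈ Finset.powersetCard m Finset.univ, principalMinor L Y / c := by
  rw [fixedSizeDPP, if_pos hX, ← Finset.sum_div, div_div_div_cancel_right₀ hc]

theorem tendsto_sqrt_nhdsGT_zero : Tendsto Real.sqrt (𝓝[>] 0) (𝓝[>] 0) := by
  refine tendsto_nhdsWithin_iff.2 ⟨?_, ?_⟩
  · simpa using (Real.continuous_sqrt.tendsto 0).mono_left nhdsWithin_le_nhds
  · filter_upwards [self_mem_nhdsWithin] with ε hε using Real.sqrt_pos.2 hε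

end FlatLimit

end

/-! ### Convergence of the ensembles and description of the limit -/

theorem mainTheorem8 {d n : ℕ} (hd : 1 ≤ d)
    (κ : EuclideanSpace ℝ (Fin d) → EuclideanSpace ℝ (Fin d) → ℝ) (f : ℝ → ℝ)
    (hκ : FlatLimit.IsStationaryKernel κ f)
    (r : ℕ∞) (hr : FlatLimit.smoothnessOrder f = r)
    (k : ℕ) (hk : (k : ℕ∞) + 1 ≤ r)
    (m : ℕ) (hm : m = FlatLimit.polyDim k d)
    (x : Fin n → EuclideanSpace ℝ (Fin d))
    (hW : (FlatLimit.wronskian k κ).det ≠ 0)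
    (hV : (FlatLimit.vandermonde k x).rank = m) :
    (∀ᶠ ε in 𝓝[>] (0 : ℝ),
      FlatLimit.IsMassFunction (FlatLimit.fixedSizeDPP m (FlatLimit.kernelMatrix κ x ε))) ∧
    FlatLimit.IsMassFunction (FlatLimit.fixedSizeDPP m
      (FlatLimit.vandermonde k x * (FlatLimit.vandermonde k x).transpose)) ∧
    (∀ X : Finset (Fin n),
      Tendsto (fun ε : ℝ => FlatLimit.fixedSizeDPP m (FlatLimit.kernelMatrix κ x ε) X) (𝓝[>] 0)
        (𝓝 (FlatLimit.fixedSizeDPP m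
          (FlatLimit.vandermonde k x * (FlatLimit.vandermonde k x).transpose) X))) ∧
    (∀ Q : Matrix (Fin n) (Fin m) ℝ,
      FlatLimit.IsOrthonormalBasisOfSpan Q (FlatLimit.vandermonde k x) →
        FlatLimit.fixedSizeDPP m
            (FlatLimit.vandermonde k x * (FlatLimit.vandermonde k x).transpose) =
          FlatLimit.fixedSizeDPP m (Q * Q.transpose) ∧
        (∀ X : Finset (Fin n),
          Tendsto (fun ε : ℝ => FlatLimit.fixedSizeDPP m (FlatLimit.kernelMatrix κ x ε) X)
            (𝓝[>] 0) (𝓝 (FlatLimit.fixedSizeDPP m (Q * Q.transpose) X))) ∧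
        FlatLimit.IsDPPWithMarginalKernel
          (FlatLimit.fixedSizeDPP m
            (FlatLimit.vandermonde k x * (FlatLimit.vandermonde k x).transpose))
          (Q * Q.transpose)) ∧
    FlatLimit.IsDiscreteOrthogonalPolynomialEnsemble k x
      (FlatLimit.fixedSizeDPP m
        (FlatLimit.vandermonde k x * (FlatLimit.vandermonde k x).transpose)) := by
  subst hm hr
  set V := FlatLimit.vandermonde k x with hVdef
  have hcard : Fintype.card (FlatLimit.multiIndices d k) = FlatLimit.polyDim k d := by
    rw [Fintype.card_coe, FlatLimit.card_multiIndices]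
  -- The normalising constant of the limit is the Gram determinant of `V`, nonzero by the rank
  -- hypothesis.
  have hsum : ∑ Y ∈ Finset.powersetCard (FlatLimit.polyDim k d) Finset.univ,
      FlatLimit.principalMinor (V * V.transpose) Y ≠ 0 := by
    rw [← hcard, FlatLimit.sum_powersetCard_principalMinor_mul_transpose]
    exact FlatLimit.det_transpose_mul_self_ne_zero (hV.trans hcard.symm)
  set s := 2 * ∑ α : FlatLimit.multiIndices d k, 2 * ∑ l, α.1 l with hs
  have hminor : ∀ X : Finset (Fin n), X.card = FlatLimit.polyDim k d →
      Tendsto (fun ε => FlatLimit.principalMinor (FlatLimit.kernelMatrix κ x ε) X /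
        Real.sqrt ε ^ s) (𝓝[>] 0)
        (𝓝 ((FlatLimit.wronskian k κ).det * FlatLimit.principalMinor (V * V.transpose) X)) := by
    intro X hX
    refine ((FlatLimit.tendsto_principalMinor_kernelMatrix_div hκ hk x hX).comp
      FlatLimit.tendsto_sqrt_nhdsGT_zero).congr' ?_
    filter_upwards [self_mem_nhdsWithin] with ε hε
    simp only [Function.comp, Real.sq_sqrt (le_of_lt hε)]
    rfl
  have hsumlim : Tendsto (fun ε => ∑ Y ∈ Finset.powersetCard (FlatLimit.polyDim k d) Finset.univ,
      FlatLimit.principalMinor (FlatLimit.kernelMatrix κ x ε) Y / Real.sqrt ε ^ s) (𝓝[>] 0)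
      (𝓝 ((FlatLimit.wronskian k κ).det *
        ∑ Y ∈ Finset.powersetCard (FlatLimit.polyDim k d) Finset.univ,
          FlatLimit.principalMinor (V * V.transpose) Y)) := by
    rw [Finset.mul_sum]
    exact tendsto_finsetSum _ fun Y hY => hminor Y (Finset.mem_powersetCard.1 hY).2
  have hlim0 := mul_ne_zero hW hsum
  have hconv : ∀ X : Finset (Fin n),
      Tendsto (fun ε : ℝ => FlatLimit.fixedSizeDPP (FlatLimit.polyDim k d)
        (FlatLimit.kernelMatrix κ x ε) X) (𝓝[>] 0)
        (𝓝 (FlatLimit.fixedSizeDPP (FlatLimit.polyDim k d) (V * V.transpose) X)) := by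
    intro X
    by_cases hX : X.card = FlatLimit.polyDim k d
    · have h := (hminor X hX).div hsumlim hlim0
      rw [mul_div_mul_left _ _ hW] at h
      rw [FlatLimit.fixedSizeDPP, if_pos hX]
      refine h.congr' ?_
      filter_upwards [self_mem_nhdsWithin] with ε hε
      exact (FlatLimit.fixedSizeDPP_eq_div _
        (pow_ne_zero _ (Real.sqrt_pos.2 hε).ne') hX).symm
    · simp [FlatLimit.fixedSizeDPP, hX]
  refine ⟨?_, FlatLimit.isMassFunction_fixedSizeDPP _ (FlatLimit.posSemidef_mul_transpose V) hsum,
    hconv, fun Q hQ => ?_, ?_⟩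
  -- The rescaled normaliser has a nonzero limit, so it is nonzero for small `ε`; nonnegativity of
  -- the masses comes from positive semi-definiteness.
  · filter_upwards [hsumlim.eventually_ne hlim0] with ε hε
    refine FlatLimit.isMassFunction_fixedSizeDPP _
      (FlatLimit.isPosSemidef_kernelMatrix hκ.posDef x ε) fun h0 => hε ?_
    rw [← Finset.sum_div, h0, zero_div]
  · have heq := FlatLimit.fixedSizeDPP_eq_of_isOrthonormalBasisOfSpan hcard hV hQ
    refine ⟨heq, fun X => heq ▸ hconv X, ?_⟩
    rw [heq]
    exact FlatLimit.isDPPWithMarginalKernel_fixedSizeDPP hQ.1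
  · obtain ⟨Q, hQ⟩ := FlatLimit.exists_isOrthonormalBasisOfSpan V hV
    rw [FlatLimit.fixedSizeDPP_eq_of_isOrthonormalBasisOfSpan hcard hV hQ]
    exact FlatLimit.isDiscreteOrthogonalPolynomialEnsemble_of_isOrthonormalBasisOfSpan hQ
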